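/- Let $d\ge 1$ and let $\Omega=(a_1,b_1)\times\dots\times(a_d,b_d)\subset\mathbb R^d$ be an open hyperrectangle with side lengths $L_i=b_i-a_i>0$. Let $\kappa\in L^\infty(\Omega)$ with $\kappa\ge 0$ almost everywhere, let $f\in L^2(\Omega)$, and let $u\in H^1_0(\Omega)$ be the weak solution of $-\Delta u+\kappa^2u=f$ in $\Omega$ with $u=0$ on $\partial\Omega$, i.e. $(\nabla u,\nabla v)+(\kappa^2u,v)=(f,v)$ for all $v\in H^1_0(\Omega)$, where $(\cdot,\cdot)$ is the $L^2(\Omega)$ inner product. Let $\mathcal T_h$ be a finite face-to-face partition of $\overline\Omega$ into closed $d$-dimensional hyperrectangles $K$ with diameters $h_K$, write $\|\cdot\|$ and $\|\cdot\|_K$ for the norms of $L^2(\Omega)$ and $L^2(K)$ (of scalar or vector functions), and let $\Pi_K$ be the $L^2(K)$-orthogonal projection onto the space $\mathbb Q_{1,\dots,1}(K)$ of polynomials of degree at most one in each of the $d$ variables. Put $|||v|||=(\|\nabla v\|^2+\|\kappa v\|^2)^{1/2}$ for $v\in H^1_0(\Omega)$ and $$C_{\mathrm P}=\frac1\pi\Big(\sum_{i=1}^dL_i^{-2}\Big)^{-1/2}.$$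 Let $u_h\in H^1_0(\Omega)$ be arbitrary, let $\boldsymbol\tau\in H(\mathrm{div},\Omega)$ be arbitrary (a square integrable vector field with square integrable distributional divergence), and put $r=f-\kappa^2u_h$. For $\kappa_0\ge 0$ put $\widetilde\kappa=\kappa+\kappa_0$ and $$\eta^2(\boldsymbol\tau)=\sum_{K\in\mathcal T_h}\big(\eta_K(\boldsymbol\tau)+\operatorname{osc}_K(r)\big)^2,\qquad \eta_K^2(\boldsymbol\tau)=\|\boldsymbol\tau-\nabla u_h\|_K^2+\|\widetilde\kappa^{-1}(\Pi_Kr+\operatorname{div}\boldsymbol\tau)\|_K^2,$$ $$\operatorname{osc}_K(r)=\min\Big\{\frac{h_K}{\pi}\|r-\Pi_Kr\|_K,\ \|\kappa^{-1}(r-\Pi_Kr)\|_K\Big\},$$ where the function $\kappa^{-1}|r-\Pi_Kr|$ is understood to be $+\infty$ at points where $\kappa=0\neq r-\Pi_Kr$ and $0$ at points where $r-\Pi_Kr=0$, and the last norm is $+\infty$ if this function is not square integrable on $K$. Then, for every $\kappa_0>0$, $$|||u-u_h|||\le\eta(\boldsymbol\tau)+\kappa_0C_{\mathrm P}\Big(\sum_{K\in\mathcal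 T_h}\|\widetilde\kappa^{-1}(\Pi_Kr+\operatorname{div}\boldsymbol\tau)\|_K^2\Big)^{1/2}.$$ Moreover, if $\operatorname{ess\,inf}_\Omega\kappa>0$, then this estimate also holds with $\kappa_0=0$ (and $\widetilde\kappa=\kappa$). -/

import Mathlib

open MeasureTheory Filter Topology Set
open scoped ENNReal Gradient Distributions

namespace ReactionDiffusion

noncomputable section

/-! ### Hyperrectangles and meshes -/

/-- The open hyperrectangle `(a₁, b₁) × ⋯ × (a_d, b_d)` in Euclidean space, where `a = B.lower` and
`b = B.upper` (the structure `BoxIntegral.Box` contains the requirement `aᵢ < bᵢ` for all `i`). -/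
def openBox {d : ℕ} (B : BoxIntegral.Box (Fin d)) :
    TopologicalSpace.Opens (EuclideanSpace ℝ (Fin d)) where
  carrier := {x | ∀ i, x i ∈ Ioo (B.lower i) (B.upper i)}
  is_open' := by
    simp only [Set.ofPred_forall]
    exact isOpen_iInter_of_finite fun i => isOpen_Ioo.preimage (by fun_prop)

/-- The closed hyperrectangle `[a₁, b₁] × ⋯ × [a_d, b_d]` in Euclidean space. -/
def closedBox {d : ℕ} (B : BoxIntegral.Box (Fin d)) : Set (EuclideanSpace ℝ (Fin d)) :=
  {x | ∀ i, x i ∈ Icc (B.lower i) (B.upper i)}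

/-- `F` is a face (of any dimension) of the closed hyperrectangle `K`: the part of `K` where some of
the coordinates are fixed to their lower, respectively upper, end points. The choice `s = t = ∅`
gives `K` itself. -/
def IsFace {d : ℕ} (F : Set (EuclideanSpace ℝ (Fin d))) (K : BoxIntegral.Box (Fin d)) : Prop :=
  ∃ s t : Set (Fin d),
    F = {x ∈ closedBox K | (∀ i ∈ s, x i = K.lower i) ∧ (∀ i ∈ t, x i = K.upper i)}

/-- `𝒯` is a finite face-to-face partition of the hyperrectangle `B` into closed
hyperrectangles. -/
structure IsMesh {d : ℕ} (B : BoxIntegral.Box (Fin d)) (𝒯 : Finset (BoxIntegral.Box (Fin d))) :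
    Prop where
  cover : ⋃ K ∈ 𝒯, closedBox K = closedBox B
  disjoint_interiors : ∀ K ∈ 𝒯, ∀ K' ∈ 𝒯, K ≠ K' →
    Disjoint (openBox K : Set (EuclideanSpace ℝ (Fin d))) (openBox K')
  face_to_face : ∀ K ∈ 𝒯, ∀ K' ∈ 𝒯, (closedBox K ∩ closedBox K').Nonempty →
    IsFace (closedBox K ∩ closedBox K') K ∧ IsFace (closedBox K ∩ closedBox K') K'

/-! ### Function spaces -/

section Spaces

variable {d : ℕ}

/-- The norm of `L²(S)`, for scalar functions and for vector fields. -/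
def l2Norm {F : Type*} [NormedAddCommGroup F] (S : Set (EuclideanSpace ℝ (Fin d)))
    (w : EuclideanSpace ℝ (Fin d) → F) : ℝ :=
  (eLpNorm w 2 (volume.restrict S)).toReal

/-- `g` is the distributional gradient of `u` in the open set `Ω`. -/
def IsWeakGrad (Ω : TopologicalSpace.Opens (EuclideanSpace ℝ (Fin d)))
    (u : EuclideanSpace ℝ (Fin d) → ℝ)
    (g : EuclideanSpace ℝ (Fin d) → EuclideanSpace ℝ (Fin d)) : Prop :=
  ∀ (φ : 𝓓(Ω, ℝ)) (i : Fin d), ∫ x in Ω, u x * (∇ φ x) i = -∫ x in Ω, g x i * φ x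

/-- `δ` is the distributional divergence of the vector field `τ` in the open set `Ω`. -/
def IsWeakDiv (Ω : TopologicalSpace.Opens (EuclideanSpace ℝ (Fin d)))
    (τ : EuclideanSpace ℝ (Fin d) → EuclideanSpace ℝ (Fin d))
    (δ : EuclideanSpace ℝ (Fin d) → ℝ) : Prop :=
  ∀ φ : 𝓓(Ω, ℝ), ∫ x in Ω, inner ℝ (τ x) (∇ φ x) = -∫ x in Ω, δ x * φ x

/-- The Sobolev space `H¹(Ω)`. -/
def MemH1 (Ω : TopologicalSpace.Opens (EuclideanSpace ℝ (Fin d)))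
    (u : EuclideanSpace ℝ (Fin d) → ℝ) : Prop :=
  MemLp u 2 (volume.restrict Ω) ∧ ∃ g, MemLp g 2 (volume.restrict Ω) ∧ IsWeakGrad Ω u g

/-- The space `H(div, Ω)`. -/
def MemHdiv (Ω : TopologicalSpace.Opens (EuclideanSpace ℝ (Fin d)))
    (τ : EuclideanSpace ℝ (Fin d) → EuclideanSpace ℝ (Fin d)) : Prop :=
  MemLp τ 2 (volume.restrict Ω) ∧ ∃ δ, MemLp δ 2 (volume.restrict Ω) ∧ IsWeakDiv Ω τ δ

open Classical in
/-- The (almost everywhere unique) distributional gradient of a function in `H¹(Ω)`. -/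
def weakGrad (Ω : TopologicalSpace.Opens (EuclideanSpace ℝ (Fin d)))
    (u : EuclideanSpace ℝ (Fin d) → ℝ) : EuclideanSpace ℝ (Fin d) → EuclideanSpace ℝ (Fin d) :=
  if h : ∃ g, MemLp g 2 (volume.restrict Ω) ∧ IsWeakGrad Ω u g then h.choose else 0

open Classical in
/-- The (almost everywhere unique) distributional divergence of a field in `H(div, Ω)`. -/
def weakDiv (Ω : TopologicalSpace.Opens (EuclideanSpace ℝ (Fin d)))
    (τ : EuclideanSpace ℝ (Fin d) → EuclideanSpace ℝ (Fin d)) : EuclideanSpace ℝ (Fin d) → ℝ :=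
  if h : ∃ δ, MemLp δ 2 (volume.restrict Ω) ∧ IsWeakDiv Ω τ δ then h.choose else 0

/-- The Sobolev space `H¹₀(Ω)`: the closure of the smooth functions with compact support in `Ω`
with respect to the norm of `H¹(Ω)`. -/
def MemH10 (Ω : TopologicalSpace.Opens (EuclideanSpace ℝ (Fin d)))
    (u : EuclideanSpace ℝ (Fin d) → ℝ) : Prop :=
  MemH1 Ω u ∧ ∃ φ : ℕ → 𝓓(Ω, ℝ),
    Tendsto (fun n => eLpNorm (fun x => u x - φ n x) 2 (volume.restrict Ω)) atTop (𝓝 0) ∧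
    Tendsto (fun n => eLpNorm (fun x => weakGrad Ω u x - ∇ (φ n) x) 2 (volume.restrict Ω))
      atTop (𝓝 0)

/-- `u ∈ H¹₀(Ω)` is the weak solution of `-Δu + κ² u = f` in `Ω`, `u = 0` on `∂Ω`. -/
def IsWeakSolution (Ω : TopologicalSpace.Opens (EuclideanSpace ℝ (Fin d)))
    (κ f u : EuclideanSpace ℝ (Fin d) → ℝ) : Prop :=
  MemH10 Ω u ∧ ∀ v, MemH10 Ω v →
    (∫ x in Ω, inner ℝ (weakGrad Ω u x) (weakGrad Ω v x)) + ∫ x in Ω, κ x ^ 2 * u x * v x =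
      ∫ x in Ω, f x * v x

/-- The energy norm `(‖∇v‖² + ‖κ v‖²)^{1/2}`. -/
def energyNorm (Ω : TopologicalSpace.Opens (EuclideanSpace ℝ (Fin d)))
    (κ v : EuclideanSpace ℝ (Fin d) → ℝ) : ℝ :=
  √(l2Norm (Ω : Set _) (weakGrad Ω v) ^ 2 + l2Norm (Ω : Set _) (fun x => κ x * v x) ^ 2)

end Spaces

/-! ### The projection onto functions that are affine in each variable -/

section Projection

variable {d : ℕ}

/-- The monomial `∏_{i ∈ S} xᵢ`. -/
def monomialQ1 (S : Finset (Fin d)) (x : EuclideanSpace ℝ (Fin d)) : ℝ := ∏ i ∈ S, x i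

theorem isCompact_closedBox (K : BoxIntegral.Box (Fin d)) : IsCompact (closedBox K) := by
  have h : closedBox K = (EuclideanSpace.equiv (Fin d) ℝ) ⁻¹' (Icc K.lower K.upper) := by
    ext x
    simp [closedBox, Pi.le_def, forall_and]
  rw [h]
  exact (EuclideanSpace.equiv (Fin d) ℝ).toHomeomorph.isCompact_preimage.2 isCompact_Icc

theorem memLp_monomialQ1 (K : BoxIntegral.Box (Fin d)) (S : Finset (Fin d)) :
    MemLp (monomialQ1 S) 2 (volume.restrict (closedBox K)) := by
  have hc : Continuous (monomialQ1 S) := by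
    unfold monomialQ1
    fun_prop
  have : IsFiniteMeasure (volume.restrict (closedBox K)) :=
    ⟨by simpa using (isCompact_closedBox K).measure_lt_top⟩
  obtain ⟨C, hC⟩ := (isCompact_closedBox K).exists_bound_of_continuousOn hc.continuousOn
  exact MemLp.of_bound hc.aestronglyMeasurable C
    (ae_restrict_of_forall_mem (isCompact_closedBox K).measurableSet hC)

/-- The space `ℚ_{1,…,1}(K)` of polynomials of degree at most one in each of the `d` variables, as a
subspace of `L²(K)`: the linear span of the monomials `∏_{i ∈ S} xᵢ`, `S ⊆ {1, …, d}`. -/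
def spaceQ1 (K : BoxIntegral.Box (Fin d)) :
    Submodule ℝ (Lp ℝ 2 (volume.restrict (closedBox K))) :=
  Submodule.span ℝ (Set.range fun S : Finset (Fin d) => (memLp_monomialQ1 K S).toLp (monomialQ1 S))

instance (K : BoxIntegral.Box (Fin d)) : FiniteDimensional ℝ (spaceQ1 K) :=
  FiniteDimensional.span_of_finite ℝ (Set.finite_range _)

open Classical in
/-- The `L²(K)`-orthogonal projection `Π_K w` of `w ∈ L²(K)` onto `ℚ_{1,…,1}(K)`. -/
def projQ1 (K : BoxIntegral.Box (Fin d)) (w : EuclideanSpace ℝ (Fin d) → ℝ) :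
    EuclideanSpace ℝ (Fin d) → ℝ :=
  if h : MemLp w 2 (volume.restrict (closedBox K)) then (spaceQ1 K).starProjection (h.toLp w) else 0

end Projection

/-! ### The error estimator -/

section Estimator

variable {d : ℕ}

/-- `r = f - κ² u_h`. -/
def resid (κ f uh : EuclideanSpace ℝ (Fin d) → ℝ) (x : EuclideanSpace ℝ (Fin d)) : ℝ :=
  f x - κ x ^ 2 * uh x

/-- `osc_K(r) = min {h_K π⁻¹ ‖r - Π_K r‖_K, ‖κ⁻¹ (r - Π_K r)‖_K}`, computed in `[0, ∞]`. The quotient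
`|r - Π_K r| / κ` is `∞` at points where `κ = 0` and `r - Π_K r ≠ 0`, so that the second norm may be
infinite (the first one is finite for `r ∈ L²(K)`). -/
def osc (K : BoxIntegral.Box (Fin d)) (κ r : EuclideanSpace ℝ (Fin d) → ℝ) : ℝ :=
  (min
    (ENNReal.ofReal (Metric.diam (closedBox K) * Real.pi⁻¹) *
      eLpNorm (fun x => r x - projQ1 K r x) 2 (volume.restrict (closedBox K)))
    (eLpNorm (fun x => ‖r x - projQ1 K r x‖ₑ / ENNReal.ofReal (κ x)) 2
      (volume.restrict (closedBox K)))).toReal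

/-- `‖(κ + κ₀)⁻¹ (Π_K r + div τ)‖_K`. -/
def residNorm (Ω : TopologicalSpace.Opens (EuclideanSpace ℝ (Fin d)))
    (K : BoxIntegral.Box (Fin d)) (κ r : EuclideanSpace ℝ (Fin d) → ℝ) (κ₀ : ℝ)
    (τ : EuclideanSpace ℝ (Fin d) → EuclideanSpace ℝ (Fin d)) : ℝ :=
  l2Norm (closedBox K) fun x => (κ x + κ₀)⁻¹ * (projQ1 K r x + weakDiv Ω τ x)

/-- `η_K(τ) = (‖τ - ∇u_h‖_K² + ‖(κ + κ₀)⁻¹ (Π_K r + div τ)‖_K²)^{1/2}`. -/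
def localEta (Ω : TopologicalSpace.Opens (EuclideanSpace ℝ (Fin d)))
    (K : BoxIntegral.Box (Fin d)) (κ f uh : EuclideanSpace ℝ (Fin d) → ℝ) (κ₀ : ℝ)
    (τ : EuclideanSpace ℝ (Fin d) → EuclideanSpace ℝ (Fin d)) : ℝ :=
  √(l2Norm (closedBox K) (fun x => τ x - weakGrad Ω uh x) ^ 2 +
    residNorm Ω K κ (resid κ f uh) κ₀ τ ^ 2)

/-- `η(τ) = (∑_K (η_K(τ) + osc_K(r))²)^{1/2}`. -/
def eta (Ω : TopologicalSpace.Opens (EuclideanSpace ℝ (Fin d)))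
    (𝒯 : Finset (BoxIntegral.Box (Fin d))) (κ f uh : EuclideanSpace ℝ (Fin d) → ℝ) (κ₀ : ℝ)
    (τ : EuclideanSpace ℝ (Fin d) → EuclideanSpace ℝ (Fin d)) : ℝ :=
  √(∑ K ∈ 𝒯, (localEta Ω K κ f uh κ₀ τ + osc K κ (resid κ f uh)) ^ 2)

/-- `C_P = π⁻¹ (∑ᵢ Lᵢ⁻²)^{-1/2}`, where `Lᵢ` are the side lengths of the hyperrectangle `B`. -/
def poincareConst (B : BoxIntegral.Box (Fin d)) : ℝ :=
  Real.pi⁻¹ * (√(∑ i, ((B.upper i - B.lower i) ^ 2)⁻¹))⁻¹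

end Estimator

end

end ReactionDiffusion

open ReactionDiffusion

/-!
The error `e = u - u_h` lies in `H¹₀(Ω)`. Testing the weak formulation with `e` and integrating
`(τ, ∇e)` by parts gives the error equation
`|||e|||² = ∑_K [(Π_K r + div τ, e)_K + (τ - ∇u_h, ∇e)_K + (r - Π_K r, e)_K]`
(`energyNorm_sq_eq`). On one element `K` (`local_error_bound`):

* the first term equals `((κ + κ₀)⁻¹ (Π_K r + div τ), κ e + κ₀ e)_K`, and Cauchy–Schwarz splits it into
  a part controlled by `‖κ e‖_K` and a part controlled by `κ₀ ‖e‖_K`;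
* the second term is at most `‖τ - ∇u_h‖_K ‖∇e‖_K`;
* the third term is at most `osc_K(r)` times the energy norm of `e` on `K`
  (`abs_integral_sub_projQ1_mul_le`), either by Cauchy–Schwarz with weight `κ`, or by the Poincaré
  inequality on `K` with constant `h_K / π`, because `r - Π_K r` has mean value zero.

Summation with the discrete Cauchy–Schwarz inequality, and the Friedrichs inequality
`‖e‖ ≤ C_P ‖∇e‖` for the remaining terms `κ₀ ‖e‖_K`, give the bound (`energyNorm_sub_le`). The
argument runs whenever `κ + κ₀` has a positive essential lower bound, which covers both `κ₀ > 0` and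
`κ₀ = 0 < ess inf κ`.

The two inequalities with sharp constants are reduced to one dimension. There, functions vanishing at
the end points are treated by completing a square with `cos (l (x - (a + b) / 2))`, `l < π / L`
(`sq_mul_integral_sq_le_of_lt`), and the inequality for the deviation from the mean value follows by
duality (`mul_integral_sq_sub_sq_integral_le`). On boxes, the Friedrichs inequality is obtained by
integrating the one-dimensional one along each coordinate direction, and the Poincaré inequality by
induction on the dimension from the tensorization of the variance (`variance_prod_le`,
`HasContinuousPartials.variance_le`). Both pass from test functions to `H¹₀` by density.
-/

/-! ### The norm of `L²` -/

section L2

variable {α F : Type*} [MeasurableSpace α] {μ : Measure α} [NormedAddCommGroup F]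

theorem toReal_eLpNorm_sq {w : α → F} (hw : MemLp w 2 μ) :
    (eLpNorm w 2 μ).toReal ^ 2 = ∫ x, ‖w x‖ ^ 2 ∂μ := by
  rw [hw.eLpNorm_eq_integral_rpow_norm two_ne_zero ENNReal.ofNat_ne_top,
    ENNReal.toReal_ofReal (by positivity), ← Real.rpow_natCast, ← Real.rpow_mul (by positivity)]
  simp

variable [InnerProductSpace ℝ F]

theorem integral_inner_toLp {v w : α → F} (hv : MemLp v 2 μ) (hw : MemLp w 2 μ) :
    ∫ x, inner ℝ (v x) (w x) ∂μ = inner ℝ (hv.toLp v) (hw.toLp w) := by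
  rw [L2.inner_def]
  apply integral_congr_ae
  filter_upwards [hv.coeFn_toLp, hw.coeFn_toLp] with x h1 h2
  rw [h1, h2]

theorem integrable_inner_of_memLp {v w : α → F} (hv : MemLp v 2 μ) (hw : MemLp w 2 μ) :
    Integrable (fun x => inner ℝ (v x) (w x)) μ := by
  refine (L2.integrable_inner (𝕜 := ℝ) (hv.toLp v) (hw.toLp w)).congr ?_
  filter_upwards [hv.coeFn_toLp, hw.coeFn_toLp] with x h1 h2
  rw [h1, h2]

theorem abs_integral_inner_le {v w : α → F} (hv : MemLp v 2 μ) (hw : MemLp w 2 μ) :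
    |∫ x, inner ℝ (v x) (w x) ∂μ| ≤ (eLpNorm v 2 μ).toReal * (eLpNorm w 2 μ).toReal := by
  rw [integral_inner_toLp hv hw]
  simpa using abs_real_inner_le_norm (hv.toLp v) (hw.toLp w)

theorem integrable_mul_of_memLp {v w : α → ℝ} (hv : MemLp v 2 μ) (hw : MemLp w 2 μ) :
    Integrable (fun x => v x * w x) μ := by
  simpa [mul_comm] using integrable_inner_of_memLp hv hw

theorem abs_integral_mul_le {v w : α → ℝ} (hv : MemLp v 2 μ) (hw : MemLp w 2 μ) :
    |∫ x, v x * w x ∂μ| ≤ (eLpNorm v 2 μ).toReal * (eLpNorm w 2 μ).toReal := by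
  simpa [mul_comm] using abs_integral_inner_le hv hw

theorem sq_integral_mul_le {v w : α → ℝ} (hv : MemLp v 2 μ) (hw : MemLp w 2 μ) :
    (∫ x, v x * w x ∂μ) ^ 2 ≤ (∫ x, v x ^ 2 ∂μ) * ∫ x, w x ^ 2 ∂μ := by
  have h := abs_integral_mul_le hv hw
  have h1 := toReal_eLpNorm_sq hv
  have h2 := toReal_eLpNorm_sq hw
  simp only [Real.norm_eq_abs, sq_abs] at h1 h2
  rw [← h1, ← h2, ← mul_pow, ← sq_abs]
  gcongr

theorem sq_integral_le [IsFiniteMeasure μ] {w : α → ℝ} (hw : MemLp w 2 μ) :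
    (∫ x, w x ∂μ) ^ 2 ≤ μ.real univ * ∫ x, w x ^ 2 ∂μ := by
  simpa using sq_integral_mul_le (memLp_const (1 : ℝ)) hw

end L2

/-! ### Poincaré inequalities in one dimension -/

/-- A quantitative form of positivity of `-d²/dx² - l²` on functions vanishing at the end points:
`w(x) = cos (l (x - (a + b) / 2))` is positive on `[a, b]` and satisfies `w'' = -l² w`, so that
`f'² - l² f² = (f' - f w' / w)² + (f² w' / w)'`. -/
theorem sq_mul_integral_sq_le_of_lt {a b l : ℝ} (hab : a < b) (hl : 0 < l)
    (hlt : l * (b - a) < Real.pi) {f f' : ℝ → ℝ} (hf : ∀ x, HasDerivAt f (f' x) x)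
    (hf' : Continuous f') (ha : f a = 0) (hb : f b = 0) :
    l ^ 2 * ∫ x in a..b, f x ^ 2 ≤ ∫ x in a..b, f' x ^ 2 := by
  have hfc : Continuous f := continuous_iff_continuousAt.2 fun x => (hf x).continuousAt
  set w : ℝ → ℝ := fun x => Real.cos (l * (x - (a + b) / 2)) with hw
  set w' : ℝ → ℝ := fun x => -(l * Real.sin (l * (x - (a + b) / 2))) with hw'
  have hwpos : ∀ x ∈ uIcc a b, 0 < w x := by
    intro x hx
    rw [uIcc_of_le hab.le] at hx
    apply Real.cos_pos_of_mem_Ioo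
    constructor <;> nlinarith [hx.1, hx.2]
  have hwd : ∀ x, HasDerivAt w (w' x) x := by
    intro x
    have h1 : HasDerivAt (fun x => l * (x - (a + b) / 2)) l x := by
      simpa using ((hasDerivAt_id x).sub_const ((a + b) / 2)).const_mul l
    simpa [hw, hw', mul_comm] using h1.cos
  have hwd' : ∀ x, HasDerivAt w' (-(l ^ 2 * w x)) x := by
    intro x
    have h1 : HasDerivAt (fun x => l * (x - (a + b) / 2)) l x := by
      simpa using ((hasDerivAt_id x).sub_const ((a + b) / 2)).const_mul l
    refine (h1.sin.const_mul l).neg.congr_deriv ?_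
    simp only [hw]
    ring
  have hwc : Continuous w := continuous_iff_continuousAt.2 fun x => (hwd x).continuousAt
  have hwc' : Continuous w' := continuous_iff_continuousAt.2 fun x => (hwd' x).continuousAt
  have hne : ∀ x ∈ uIcc a b, w x ≠ 0 := fun x hx => (hwpos x hx).ne'
  have hcq : ContinuousOn (fun x => (f' x - f x * w' x / w x) ^ 2) (uIcc a b) :=
    (hf'.continuousOn.sub ((hfc.mul hwc').continuousOn.div hwc.continuousOn hne)).pow 2
  have hcd : Continuous fun x => f' x ^ 2 - l ^ 2 * f x ^ 2 := by fun_prop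
  have key : ∫ x in a..b, (f' x ^ 2 - l ^ 2 * f x ^ 2 - (f' x - f x * w' x / w x) ^ 2) =
      f b ^ 2 * w' b / w b - f a ^ 2 * w' a / w a := by
    refine intervalIntegral.integral_eq_sub_of_hasDerivAt
      (f := fun x => f x ^ 2 * w' x / w x) (fun x hx => ?_)
      (hcd.continuousOn.sub hcq).intervalIntegrable
    refine (((hf x).fun_pow 2).fun_mul (hwd' x)).fun_div (hwd x) (hne x hx) |>.congr_deriv ?_
    have := hne x hx
    simp only [Nat.cast_ofNat, Nat.add_one_sub_one, pow_one]
    field_simp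
    ring
  have hi : ∀ {v : ℝ → ℝ}, Continuous v → IntervalIntegrable v volume a b :=
    fun hv => hv.intervalIntegrable _ _
  rw [intervalIntegral.integral_sub (hi hcd) hcq.intervalIntegrable,
    intervalIntegral.integral_sub (hi (by fun_prop)) (hi (by fun_prop)),
    intervalIntegral.integral_const_mul, ha, hb] at key
  have hnn : 0 ≤ ∫ x in a..b, (f' x - f x * w' x / w x) ^ 2 :=
    intervalIntegral.integral_nonneg hab.le fun x _ => sq_nonneg _
  simp at key
  linarith

/-- The Poincaré inequality for functions vanishing at the end points, with the optimal constant. -/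
theorem integral_sq_le_of_eq_zero {a b : ℝ} (hab : a < b) {f f' : ℝ → ℝ}
    (hf : ∀ x, HasDerivAt f (f' x) x) (hf' : Continuous f') (ha : f a = 0) (hb : f b = 0) :
    ∫ x in a..b, f x ^ 2 ≤ ((b - a) / Real.pi) ^ 2 * ∫ x in a..b, f' x ^ 2 := by
  have hL : 0 < b - a := sub_pos.2 hab
  set I := ∫ x in a..b, f x ^ 2
  set J := ∫ x in a..b, f' x ^ 2
  have hlim : Tendsto (fun l : ℝ => l ^ 2 * I) (𝓝[<] (Real.pi / (b - a)))
      (𝓝 ((Real.pi / (b - a)) ^ 2 * I)) :=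
    ((continuous_id.pow 2).mul continuous_const).continuousAt.continuousWithinAt
  have hle : (Real.pi / (b - a)) ^ 2 * I ≤ J := by
    refine le_of_tendsto hlim ?_
    filter_upwards [Ioo_mem_nhdsLT (show 0 < Real.pi / (b - a) by positivity)] with l hl
    exact sq_mul_integral_sq_le_of_lt hab hl.1 ((lt_div_iff₀ hL).1 hl.2) hf hf' ha hb
  calc I = ((b - a) / Real.pi) ^ 2 * ((Real.pi / (b - a)) ^ 2 * I) := by
        have := Real.pi_pos
        field_simp
    _ ≤ _ := by gcongr

/-- The Poincaré inequality for the deviation from the mean value, with the optimal constant, in a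
form free of quotients. It follows from the inequality for functions vanishing at the end points,
applied to the primitive `g` of `f - mean f`: integration by parts gives
`‖g'‖² = -(g, g'') ≤ (L / π) ‖g'‖ ‖g''‖`. -/
theorem mul_integral_sq_sub_sq_integral_le {a b : ℝ} (hab : a < b) {f f' : ℝ → ℝ}
    (hf : ∀ x, HasDerivAt f (f' x) x) (hf' : Continuous f') :
    (b - a) * (∫ x in a..b, f x ^ 2) - (∫ x in a..b, f x) ^ 2 ≤
      (b - a) * (((b - a) / Real.pi) ^ 2 * ∫ x in a..b, f' x ^ 2) := by
  have hfc : Continuous f := continuous_iff_continuousAt.2 fun x => (hf x).continuousAt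
  have hL : 0 < b - a := sub_pos.2 hab
  set m : ℝ := (∫ x in a..b, f x) / (b - a) with hm
  set h : ℝ → ℝ := fun x => f x - m with hh
  have hhc : Continuous h := by fun_prop
  have hhd : ∀ x, HasDerivAt h (f' x) x := fun x => (hf x).sub_const m
  set g : ℝ → ℝ := fun x => ∫ t in a..x, h t with hg
  have hgd : ∀ x, HasDerivAt g (h x) x := fun x =>
    intervalIntegral.integral_hasDerivAt_right (hhc.intervalIntegrable _ _)
      (hhc.stronglyMeasurableAtFilter _ _) hhc.continuousAt
  have hgc : Continuous g := continuous_iff_continuousAt.2 fun x => (hgd x).continuousAt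
  have hga : g a = 0 := intervalIntegral.integral_same
  have hgb : g b = 0 := by
    simp only [hg, hh]
    rw [intervalIntegral.integral_sub (hfc.intervalIntegrable _ _) (by simp)]
    simp only [intervalIntegral.integral_const, smul_eq_mul, hm]
    field_simp
    ring
  have hD := integral_sq_le_of_eq_zero hab hgd hhc hga hgb
  have hparts : ∫ x in a..b, h x ^ 2 = -∫ x in a..b, g x * f' x := by
    have := intervalIntegral.integral_mul_deriv_eq_deriv_mul (a := a) (b := b)
      (fun x _ => hhd x) (fun x _ => hgd x) (hf'.intervalIntegrable _ _)
      (hhc.intervalIntegrable _ _)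
    rw [hga, hgb] at this
    simp only [mul_zero, sub_zero, zero_sub] at this
    simpa [sq, mul_comm] using this
  have hCS : (∫ x in a..b, g x * f' x) ^ 2 ≤
      (∫ x in a..b, g x ^ 2) * ∫ x in a..b, f' x ^ 2 := by
    have hmem : ∀ {v : ℝ → ℝ}, Continuous v → MemLp v 2 (volume.restrict (Ioc a b)) := by
      intro v hv
      obtain ⟨C, hC⟩ := isCompact_Icc.exists_bound_of_continuousOn
        (hv.continuousOn (s := Icc a b))
      exact MemLp.of_bound hv.aestronglyMeasurable C
        (ae_restrict_of_forall_mem measurableSet_Ioc fun x hx => hC x (Ioc_subset_Icc_self hx))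
    simp only [intervalIntegral.integral_of_le hab.le]
    exact sq_integral_mul_le (hmem hgc) (hmem hf')
  have hexp : (b - a) * (∫ x in a..b, f x ^ 2) - (∫ x in a..b, f x) ^ 2 =
      (b - a) * ∫ x in a..b, h x ^ 2 := by
    have : ∀ x, h x ^ 2 = f x ^ 2 - 2 * m * f x + m ^ 2 := fun x => by simp only [hh]; ring
    simp_rw [this]
    have hi : ∀ {v : ℝ → ℝ}, Continuous v → IntervalIntegrable v volume a b :=
      fun hv => hv.intervalIntegrable _ _
    rw [intervalIntegral.integral_add (hi (by fun_prop)) (hi (by fun_prop)),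
      intervalIntegral.integral_sub (hi (by fun_prop)) (hi (by fun_prop)),
      intervalIntegral.integral_const_mul]
    simp only [intervalIntegral.integral_const, smul_eq_mul, hm]
    field_simp
    ring
  rw [hexp]
  gcongr
  set H := ∫ x in a..b, h x ^ 2
  set E := ∫ x in a..b, f' x ^ 2
  have hH : 0 ≤ H := intervalIntegral.integral_nonneg hab.le fun x _ => sq_nonneg _
  have hE : 0 ≤ E := intervalIntegral.integral_nonneg hab.le fun x _ => sq_nonneg _
  have hsq : H * H ≤ H * (((b - a) / Real.pi) ^ 2 * E) := by
    calc H * H = (∫ x in a..b, g x * f' x) ^ 2 := by rw [hparts]; ring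
      _ ≤ _ := hCS
      _ ≤ (((b - a) / Real.pi) ^ 2 * H) * E := by gcongr
      _ = _ := by ring
  rcases hH.eq_or_lt with h0 | h0
  · rw [← h0]; positivity
  · exact le_of_mul_le_mul_left hsq h0

/-! ### Variance on products -/

section Variance

theorem Continuous.memLp_restrict_of_isCompact {α F : Type*} [MeasurableSpace α]
    [TopologicalSpace α] [OpensMeasurableSpace α] [T2Space α] {μ : Measure α}
    [IsFiniteMeasureOnCompacts μ] [NormedAddCommGroup F] [SecondCountableTopologyEither α F]
    {v : α → F} (hv : Continuous v) {S : Set α} (hS : IsCompact S) (p : ℝ≥0∞) :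
    MemLp v p (μ.restrict S) := by
  have : IsFiniteMeasure (μ.restrict S) := ⟨by simpa using hS.measure_lt_top⟩
  borelize F
  obtain ⟨C, hC⟩ := hS.exists_bound_of_continuousOn (hv.continuousOn (s := S))
  exact MemLp.of_bound hv.aestronglyMeasurable C
    (ae_restrict_of_forall_mem hS.measurableSet hC)

theorem Continuous.integrable_restrict_of_isCompact {α F : Type*} [MeasurableSpace α]
    [TopologicalSpace α] [OpensMeasurableSpace α] [T2Space α] {μ : Measure α}
    [IsFiniteMeasureOnCompacts μ] [NormedAddCommGroup F] [SecondCountableTopologyEither α F]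
    {v : α → F} (hv : Continuous v) {S : Set α} (hS : IsCompact S) :
    Integrable v (μ.restrict S) :=
  memLp_one_iff_integrable.1 (hv.memLp_restrict_of_isCompact hS 1)

/-- The variance expressed by second and first moments; it is free of quotients, both sides being
scaled by the square of the total mass. -/
theorem integral_mul_sub_integral_sq {α : Type*} [MeasurableSpace α] {μ : Measure α}
    [IsFiniteMeasure μ] {h : α → ℝ} (hh : MemLp h 2 μ) :
    ∫ x, (μ.real univ * h x - ∫ z, h z ∂μ) ^ 2 ∂μ =
      μ.real univ * (μ.real univ * ∫ x, h x ^ 2 ∂μ - (∫ x, h x ∂μ) ^ 2) := by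
  have h1 : Integrable h μ := hh.integrable one_le_two
  have h2 : Integrable (fun x => h x ^ 2) μ := hh.integrable_sq
  set m := ∫ z, h z ∂μ with hm
  set B := μ.real univ with hB
  have : ∀ x, (B * h x - m) ^ 2 = B ^ 2 * h x ^ 2 - 2 * B * m * h x + m ^ 2 := fun x => by ring
  simp_rw [this]
  rw [integral_add (by fun_prop) (integrable_const _),
    integral_sub (h2.const_mul _) (h1.const_mul _), integral_const_mul, integral_const_mul,
    integral_const, ← hm, ← hB, smul_eq_mul]
  ring

theorem continuous_setIntegral_left {α β : Type*} [MeasurableSpace α] [TopologicalSpace α]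
    [OpensMeasurableSpace α] [TopologicalSpace β] [LocallyCompactSpace β]
    [FirstCountableTopology β] {μ : Measure α} [IsLocallyFiniteMeasure μ] {S : Set α}
    (hS : IsCompact S) {F : α × β → ℝ} (hF : Continuous F) :
    Continuous fun y => ∫ x in S, F (x, y) ∂μ :=
  continuous_parametric_integral_of_continuous (f := fun y x => F (x, y)) (by fun_prop) hS

theorem continuous_setIntegral_right {α β : Type*} [MeasurableSpace β] [TopologicalSpace β]
    [OpensMeasurableSpace β] [TopologicalSpace α] [LocallyCompactSpace α]
    [FirstCountableTopology α] {ν : Measure β} [IsLocallyFiniteMeasure ν] {T : Set β}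
    (hT : IsCompact T) {F : α × β → ℝ} (hF : Continuous F) :
    Continuous fun x => ∫ y in T, F (x, y) ∂ν :=
  continuous_parametric_integral_of_continuous (f := fun x y => F (x, y)) (by fun_prop) hT

variable {α β : Type*} [MeasurableSpace α] [TopologicalSpace α] [OpensMeasurableSpace α]
  [T2Space α]
  [MeasurableSpace β] [TopologicalSpace β]
  [OpensMeasurableSpace β] [T2Space β] [SecondCountableTopology β]
  {μ : Measure α} {ν : Measure β}
  [IsFiniteMeasureOnCompacts μ] [IsFiniteMeasureOnCompacts ν] [SFinite μ] [SFinite ν]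

theorem integrable_prod_restrict {S : Set α} {T : Set β} (hS : IsCompact S) (hT : IsCompact T)
    {F : α × β → ℝ} (hF : Continuous F) :
    Integrable F ((μ.restrict S).prod (ν.restrict T)) := by
  have : IsFiniteMeasure (μ.restrict S) := ⟨by simpa using hS.measure_lt_top⟩
  have : IsFiniteMeasure (ν.restrict T) := ⟨by simpa using hT.measure_lt_top⟩
  obtain ⟨C, hC⟩ := (hS.prod hT).exists_bound_of_continuousOn (hF.continuousOn)
  refine Integrable.of_bound hF.aestronglyMeasurable C ?_
  rw [Measure.prod_restrict]
  exact ae_restrict_of_forall_mem (hS.measurableSet.prod hT.measurableSet) hC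

theorem setIntegral_setIntegral_swap {S : Set α} {T : Set β} (hS : IsCompact S) (hT : IsCompact T)
    {F : α × β → ℝ} (hF : Continuous F) :
    ∫ y in T, ∫ x in S, F (x, y) ∂μ ∂ν = ∫ x in S, ∫ y in T, F (x, y) ∂ν ∂μ := by
  rw [← integral_prod _ (integrable_prod_restrict hS hT hF),
    ← integral_prod_symm _ (integrable_prod_restrict hS hT hF)]

variable [SecondCountableTopology α] [LocallyCompactSpace α] [LocallyCompactSpace β]

/-- Jensen's inequality for the (unnormalized) variance: the variance of the average over `S` is at
most the average over `S` of the variances. -/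
theorem variance_setIntegral_le {S : Set α} {T : Set β} (hS : IsCompact S) (hT : IsCompact T)
    (hTpos : 0 < ν.real T) {F : α × β → ℝ} (hF : Continuous F) :
    ν.real T * (∫ y in T, (∫ x in S, F (x, y) ∂μ) ^ 2 ∂ν) -
        (∫ y in T, ∫ x in S, F (x, y) ∂μ ∂ν) ^ 2 ≤
      μ.real S * ∫ x in S, (ν.real T * (∫ y in T, F (x, y) ^ 2 ∂ν) -
        (∫ y in T, F (x, y) ∂ν) ^ 2) ∂μ := by
  have : IsFiniteMeasure (μ.restrict S) := ⟨by simpa using hS.measure_lt_top⟩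
  have : IsFiniteMeasure (ν.restrict T) := ⟨by simpa using hT.measure_lt_top⟩
  have hG := continuous_setIntegral_left (μ := μ) hS hF
  have hm := continuous_setIntegral_right (ν := ν) hT hF
  set B := ν.real T with hB
  set m := fun x => ∫ y in T, F (x, y) ∂ν
  set G := fun y => ∫ x in S, F (x, y) ∂μ
  have hB' : (ν.restrict T).real univ = B := by simp [hB]
  have hA' : (μ.restrict S).real univ = μ.real S := by simp
  have hswap := setIntegral_setIntegral_swap (μ := μ) (ν := ν) hS hT hF
  have hFx : ∀ x, Continuous fun y => F (x, y) := fun x => by fun_prop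
  have hFy : ∀ y, Continuous fun x => F (x, y) := fun y => by fun_prop
  have hmS : ∀ {v : α → ℝ}, Continuous v → MemLp v 2 (μ.restrict S) :=
    fun hv => hv.memLp_restrict_of_isCompact hS 2
  have hmT : ∀ {v : β → ℝ}, Continuous v → MemLp v 2 (ν.restrict T) :=
    fun hv => hv.memLp_restrict_of_isCompact hT 2
  have hF1 : Continuous fun z : α × β => B * F z - m z.1 := by fun_prop
  have hslice : ∀ y, ∫ x in S, (B * F (x, y) - m x) ∂μ = B * G y - ∫ y in T, G y ∂ν := by
    intro y
    rw [integral_sub ((hFy y).integrable_restrict_of_isCompact hS |>.const_mul _)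
      (hm.integrable_restrict_of_isCompact hS), integral_const_mul, hswap]
  -- The integral of `B F(·, y) - m` over `S` is the deviation of `B G` from its mean value, so
  -- Cauchy–Schwarz on `S` applies for each `y`.
  have h1 : ∫ y in T, (B * G y - ∫ y in T, G y ∂ν) ^ 2 ∂ν ≤
      ∫ y in T, μ.real S * ∫ x in S, (B * F (x, y) - m x) ^ 2 ∂μ ∂ν := by
    refine integral_mono ?_ ?_ fun y => ?_
    · exact (hmT (by fun_prop : Continuous fun y => B * G y - ∫ y in T, G y ∂ν)).integrable_sq
    · refine (Continuous.const_mul ?_ _).integrable_restrict_of_isCompact hT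
      exact continuous_setIntegral_left (F := fun z : α × β => (B * F z - m z.1) ^ 2) hS
        (hF1.fun_pow 2)
    · simp only [← hslice, ← hA']
      exact sq_integral_le (hmS (hF1.comp (Continuous.prodMk_left y)))
  have h2 : ∫ y in T, μ.real S * ∫ x in S, (B * F (x, y) - m x) ^ 2 ∂μ ∂ν =
      B * (μ.real S * ∫ x in S, (B * (∫ y in T, F (x, y) ^ 2 ∂ν) - m x ^ 2) ∂μ) := by
    rw [integral_const_mul,
      setIntegral_setIntegral_swap (F := fun z : α × β => (B * F z - m z.1) ^ 2) hS hT
        (hF1.fun_pow 2), mul_left_comm, ← integral_const_mul B]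
    congr 1
    refine integral_congr_ae (Eventually.of_forall fun x => ?_)
    have := integral_mul_sub_integral_sq (hmT (hFx x))
    rw [hB'] at this
    exact this
  have h3 := integral_mul_sub_integral_sq (hmT hG)
  rw [hB'] at h3
  rw [h3, h2] at h1
  exact le_of_mul_le_mul_left h1 hTpos

/-- The tensorization (Efron–Stein) inequality for the unnormalized variance on a product. -/
theorem variance_prod_le {S : Set α} {T : Set β} (hS : IsCompact S) (hT : IsCompact T)
    (hTpos : 0 < ν.real T) {F : α × β → ℝ} (hF : Continuous F) :
    μ.real S * ν.real T * (∫ x in S, ∫ y in T, F (x, y) ^ 2 ∂ν ∂μ) -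
        (∫ x in S, ∫ y in T, F (x, y) ∂ν ∂μ) ^ 2 ≤
      ν.real T * (∫ y in T, (μ.real S * (∫ x in S, F (x, y) ^ 2 ∂μ) -
        (∫ x in S, F (x, y) ∂μ) ^ 2) ∂ν) +
      μ.real S * ∫ x in S, (ν.real T * (∫ y in T, F (x, y) ^ 2 ∂ν) -
        (∫ y in T, F (x, y) ∂ν) ^ 2) ∂μ := by
  have h := variance_setIntegral_le (μ := μ) (ν := ν) hS hT hTpos hF
  have hs1 := setIntegral_setIntegral_swap (μ := μ) (ν := ν) hS hT hF
  have hs2 := setIntegral_setIntegral_swap (μ := μ) (ν := ν) (F := fun z => F z ^ 2) hS hT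
    (hF.fun_pow 2)
  have hG := continuous_setIntegral_left (μ := μ) hS hF
  have hG2 := continuous_setIntegral_left (μ := μ) (F := fun z => F z ^ 2) hS (hF.fun_pow 2)
  have : IsFiniteMeasure (ν.restrict T) := ⟨by simpa using hT.measure_lt_top⟩
  rw [integral_sub ((hG2.integrable_restrict_of_isCompact hT).const_mul _)
    (hG.memLp_restrict_of_isCompact hT 2).integrable_sq, integral_const_mul, hs2]
  rw [hs1] at h
  linarith

end Variance

/-! ### Poincaré inequalities on boxes -/

section Boxes

variable {n : ℕ}

/-- `f` is continuous and has the continuous partial derivatives `D i`. Each of them is required as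
an ordinary derivative along a coordinate line, so that the notion passes to slices of `f`. -/
structure HasContinuousPartials (f : (Fin n → ℝ) → ℝ) (D : Fin n → (Fin n → ℝ) → ℝ) : Prop where
  continuous : Continuous f
  continuous_partial : ∀ i, Continuous (D i)
  hasDerivAt : ∀ x i, HasDerivAt (fun t => f (Function.update x i t)) (D i x) (x i)

theorem HasContinuousPartials.hasDerivAt_insertNth {f : (Fin (n + 1) → ℝ) → ℝ}
    {D : Fin (n + 1) → (Fin (n + 1) → ℝ) → ℝ} (h : HasContinuousPartials f D) (p : Fin (n + 1))
    (y : Fin n → ℝ) (t : ℝ) :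
    HasDerivAt (fun s => f (p.insertNth s y)) (D p (p.insertNth t y)) t := by
  simpa using h.hasDerivAt (p.insertNth t y) p

theorem HasContinuousPartials.insertNth {f : (Fin (n + 1) → ℝ) → ℝ}
    {D : Fin (n + 1) → (Fin (n + 1) → ℝ) → ℝ} (h : HasContinuousPartials f D) (p : Fin (n + 1))
    (t : ℝ) : HasContinuousPartials (fun y : Fin n → ℝ => f (p.insertNth t y))
      (fun j y => D (p.succAbove j) (p.insertNth t y)) where
  continuous := h.continuous.comp (by fun_prop)
  continuous_partial j := (h.continuous_partial _).comp (by fun_prop)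
  hasDerivAt y j := by
    simpa [Fin.insertNth_update] using h.hasDerivAt (p.insertNth t y) (p.succAbove j)

theorem measurePreserving_insertNth (p : Fin (n + 1)) (a b : Fin (n + 1) → ℝ) :
    MeasurePreserving (fun z : ℝ × (Fin n → ℝ) => (p.insertNth z.1 z.2 : Fin (n + 1) → ℝ))
      ((volume.restrict (Icc (a p) (b p))).prod
        (volume.restrict (Icc (p.removeNth a) (p.removeNth b))))
      (volume.restrict (Icc a b)) := by
  have h := ((volume_preserving_piFinSuccAbove (fun _ : Fin (n + 1) => ℝ) p).symm).restrict_preimage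
    (measurableSet_Icc (a := a) (b := b))
  rw [Measure.prod_restrict]
  have hpre : Icc (a p) (b p) ×ˢ Icc (p.removeNth a) (p.removeNth b) =
      (MeasurableEquiv.piFinSuccAbove (fun _ : Fin (n + 1) => ℝ) p).symm ⁻¹' Icc a b := by
    ext z
    exact Fin.insertNth_mem_Icc.symm
  rw [hpre]
  exact h

theorem setIntegral_Icc_insertNth (p : Fin (n + 1)) (a b : Fin (n + 1) → ℝ)
    {f : (Fin (n + 1) → ℝ) → ℝ} (hf : Continuous f) :
    ∫ x in Icc a b, f x = ∫ t in Icc (a p) (b p),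
      ∫ y in Icc (p.removeNth a) (p.removeNth b), f (p.insertNth t y) := by
  have h := measurePreserving_insertNth p a b
  rw [← h.map_eq, integral_map h.measurable.aemeasurable hf.aestronglyMeasurable,
    integral_prod _ (integrable_prod_restrict isCompact_Icc isCompact_Icc (by fun_prop))]

/-- The Friedrichs inequality in one coordinate direction of a box. -/
theorem HasContinuousPartials.setIntegral_sq_le {f : (Fin (n + 1) → ℝ) → ℝ}
    {D : Fin (n + 1) → (Fin (n + 1) → ℝ) → ℝ} (h : HasContinuousPartials f D) (p : Fin (n + 1))
    {a b : Fin (n + 1) → ℝ} (hab : a p < b p) (ha : ∀ x, x p = a p → f x = 0)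
    (hb : ∀ x, x p = b p → f x = 0) :
    ∫ x in Icc a b, f x ^ 2 ≤ ((b p - a p) / Real.pi) ^ 2 * ∫ x in Icc a b, D p x ^ 2 := by
  have hfc := h.continuous
  have hDc := h.continuous_partial p
  have hF : Continuous fun z : ℝ × (Fin n → ℝ) => f (p.insertNth z.1 z.2) := by fun_prop
  have hDF : Continuous fun z : ℝ × (Fin n → ℝ) => D p (p.insertNth z.1 z.2) := by fun_prop
  rw [setIntegral_Icc_insertNth p a b (hfc.fun_pow 2), setIntegral_Icc_insertNth p a b (hDc.fun_pow 2),
    ← setIntegral_setIntegral_swap (F := fun z : ℝ × (Fin n → ℝ) => f (p.insertNth z.1 z.2) ^ 2)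
      isCompact_Icc isCompact_Icc (hF.fun_pow 2),
    ← setIntegral_setIntegral_swap (F := fun z : ℝ × (Fin n → ℝ) => D p (p.insertNth z.1 z.2) ^ 2)
      isCompact_Icc isCompact_Icc (hDF.fun_pow 2), ← integral_const_mul]
  refine integral_mono ?_ ?_ fun y => ?_
  · exact (continuous_setIntegral_left isCompact_Icc (hF.fun_pow 2)).integrable_restrict_of_isCompact
      isCompact_Icc
  · exact ((continuous_setIntegral_left isCompact_Icc (hDF.fun_pow 2)).integrable_restrict_of_isCompact
      isCompact_Icc).const_mul _
  · have := integral_sq_le_of_eq_zero hab (fun t => h.hasDerivAt_insertNth p y t)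
      (by fun_prop) (ha _ (by simp)) (hb _ (by simp))
    simpa only [intervalIntegral.integral_of_le hab.le, ← integral_Icc_eq_integral_Ioc] using this

theorem volume_real_Icc_eq_mul (p : Fin (n + 1)) {a b : Fin (n + 1) → ℝ} :
    volume.real (Icc a b) = volume.real (Icc (a p) (b p)) *
      volume.real (Icc (p.removeNth a) (p.removeNth b)) := by
  simp only [Measure.real, Real.volume_Icc_pi, Real.volume_Icc, ENNReal.toReal_prod]
  rw [Fin.prod_univ_succAbove _ p]
  rfl

theorem volume_real_Icc_pos {a b : Fin n → ℝ} (hab : ∀ i, a i < b i) :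
    0 < volume.real (Icc a b) := by
  simp only [Measure.real, Real.volume_Icc_pi, ENNReal.toReal_prod]
  exact Finset.prod_pos fun i _ => by
    rw [ENNReal.toReal_ofReal (sub_pos.2 (hab i)).le]
    exact sub_pos.2 (hab i)

/-- The Poincaré inequality on a box for the deviation from the mean value: by tensorization of the
variance, the constant is governed by the side lengths rather than by the dimension. -/
theorem HasContinuousPartials.variance_le : ∀ {n : ℕ} {f : (Fin n → ℝ) → ℝ}
    {D : Fin n → (Fin n → ℝ) → ℝ}, HasContinuousPartials f D → ∀ {a b : Fin n → ℝ},
    (∀ i, a i < b i) →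
    volume.real (Icc a b) * (∫ x in Icc a b, f x ^ 2) - (∫ x in Icc a b, f x) ^ 2 ≤
      volume.real (Icc a b) *
        ∑ i, ((b i - a i) / Real.pi) ^ 2 * ∫ x in Icc a b, D i x ^ 2 := by
  intro n
  induction n with
  | zero =>
    intro f D h a b hab
    have hc : ∀ x, f x = f 0 := fun x => congrArg f (Subsingleton.elim _ _)
    simp_rw [hc]
    simp only [setIntegral_const, smul_eq_mul, Finset.univ_eq_empty, Finset.sum_empty]
    exact le_of_eq (by ring)
  | succ n ih =>
    intro f D h a b hab
    have hfc := h.continuous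
    have hDc := h.continuous_partial
    set p : Fin (n + 1) := 0
    set S := Icc (a p) (b p)
    set T : Set (Fin n → ℝ) := Icc (p.removeNth a) (p.removeNth b)
    have hS : IsCompact S := isCompact_Icc
    have hT : IsCompact T := isCompact_Icc
    have hTpos : 0 < volume.real T := volume_real_Icc_pos fun i => hab (p.succAbove i)
    have hSval : volume.real S = b p - a p := by simp [S, (hab p).le]
    have hins : Continuous fun z : ℝ × (Fin n → ℝ) => (p.insertNth z.1 z.2 : Fin (n + 1) → ℝ) := by
      fun_prop
    have hF : Continuous fun z : ℝ × (Fin n → ℝ) => f (p.insertNth z.1 z.2) := by fun_prop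
    have hDF : ∀ i, Continuous fun z : ℝ × (Fin n → ℝ) => D i (p.insertNth z.1 z.2) ^ 2 :=
      fun i => ((hDc i).comp hins).fun_pow 2
    have key := variance_prod_le (μ := volume) (ν := volume) hS hT hTpos hF
    have iS : ∀ {v : ℝ → ℝ}, Continuous v → Integrable v (volume.restrict S) :=
      fun hv => hv.integrable_restrict_of_isCompact hS
    have iT : ∀ {v : (Fin n → ℝ) → ℝ}, Continuous v → Integrable v (volume.restrict T) :=
      fun hv => hv.integrable_restrict_of_isCompact hT
    have cL : ∀ {F : ℝ × (Fin n → ℝ) → ℝ}, Continuous F → Continuous fun y => ∫ x in S, F (x, y) :=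
      fun hF => continuous_setIntegral_left hS hF
    have cR : ∀ {F : ℝ × (Fin n → ℝ) → ℝ}, Continuous F → Continuous fun x => ∫ y in T, F (x, y) :=
      fun hF => continuous_setIntegral_right hT hF
    have h1 : ∫ y in T, (volume.real S * (∫ x in S, f (p.insertNth x y) ^ 2) -
        (∫ x in S, f (p.insertNth x y)) ^ 2) ≤
        volume.real S * (((b p - a p) / Real.pi) ^ 2 * ∫ x in Icc a b, D p x ^ 2) := by
      rw [setIntegral_Icc_insertNth p a b ((hDc p).fun_pow 2),
        ← setIntegral_setIntegral_swap hS hT (hDF p), ← integral_const_mul, ← integral_const_mul]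
      refine integral_mono ?_ ?_ fun y => ?_
      · exact iT (((cL (hF.fun_pow 2)).const_mul _).sub ((cL hF).fun_pow 2))
      · exact iT (((cL (hDF p)).const_mul _).const_mul _)
      · have := mul_integral_sq_sub_sq_integral_le (hab p)
          (fun t => h.hasDerivAt_insertNth p y t) (by fun_prop)
        simpa only [intervalIntegral.integral_of_le (hab p).le, ← integral_Icc_eq_integral_Ioc,
          hSval] using this
    have h2 : ∫ x in S, (volume.real T * (∫ y in T, f (p.insertNth x y) ^ 2) -
        (∫ y in T, f (p.insertNth x y)) ^ 2) ≤
        volume.real T * ∑ j, ((b (p.succAbove j) - a (p.succAbove j)) / Real.pi) ^ 2 *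
          ∫ x in Icc a b, D (p.succAbove j) x ^ 2 := by
      have hrw : ∀ j, ((b (p.succAbove j) - a (p.succAbove j)) / Real.pi) ^ 2 *
          ∫ x in Icc a b, D (p.succAbove j) x ^ 2 = ∫ x in S,
            ((b (p.succAbove j) - a (p.succAbove j)) / Real.pi) ^ 2 *
              ∫ y in T, D (p.succAbove j) (p.insertNth x y) ^ 2 := fun j => by
        rw [setIntegral_Icc_insertNth p a b ((hDc _).fun_pow 2), integral_const_mul]
      have ij : ∀ j ∈ (Finset.univ : Finset (Fin n)), Integrable (fun x =>
            ((b (p.succAbove j) - a (p.succAbove j)) / Real.pi) ^ 2 *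
              ∫ y in T, D (p.succAbove j) (p.insertNth x y) ^ 2) (volume.restrict S) :=
        fun j _ => iS ((cR (hDF _)).const_mul _)
      simp_rw [hrw]
      rw [← integral_finsetSum _ ij, ← integral_const_mul]
      refine integral_mono ?_ ?_ fun x => ?_
      · exact iS (((cR (hF.fun_pow 2)).const_mul _).sub ((cR hF).fun_pow 2))
      · exact (integrable_finsetSum _ ij).const_mul _
      · exact ih (h.insertNth p x) fun i => hab (p.succAbove i)
    rw [setIntegral_Icc_insertNth p a b (hfc.fun_pow 2), setIntegral_Icc_insertNth p a b hfc,
      volume_real_Icc_eq_mul p, Fin.sum_univ_succAbove _ p]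
    calc _ ≤ _ := key
      _ ≤ volume.real T * (volume.real S * (((b p - a p) / Real.pi) ^ 2 *
            ∫ x in Icc a b, D p x ^ 2)) +
          volume.real S * (volume.real T *
            ∑ j, ((b (p.succAbove j) - a (p.succAbove j)) / Real.pi) ^ 2 *
              ∫ x in Icc a b, D (p.succAbove j) x ^ 2) := by gcongr
      _ = _ := by ring

end Boxes

/-! ### Hyperrectangles in Euclidean space -/

section EuclideanBoxes

variable {d : ℕ}

theorem closedBox_eq_preimage (K : BoxIntegral.Box (Fin d)) :
    closedBox K = WithLp.ofLp ⁻¹' Icc K.lower K.upper := by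
  ext x
  simp [closedBox, Pi.le_def, forall_and]

theorem openBox_eq_preimage (K : BoxIntegral.Box (Fin d)) :
    (openBox K : Set (EuclideanSpace ℝ (Fin d))) =
      WithLp.ofLp ⁻¹' univ.pi fun i => Ioo (K.lower i) (K.upper i) := by
  ext x
  simp [openBox]

theorem openBox_ae_eq_closedBox (K : BoxIntegral.Box (Fin d)) :
    (openBox K : Set (EuclideanSpace ℝ (Fin d))) =ᵐ[volume] closedBox K := by
  rw [closedBox_eq_preimage, openBox_eq_preimage]
  exact (PiLp.volume_preserving_ofLp (Fin d)).quasiMeasurePreserving.preimage_ae_eq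
    Measure.univ_pi_Ioo_ae_eq_Icc

theorem restrict_openBox (K : BoxIntegral.Box (Fin d)) :
    (volume : Measure (EuclideanSpace ℝ (Fin d))).restrict (openBox K) =
      volume.restrict (closedBox K) :=
  Measure.restrict_congr_set (openBox_ae_eq_closedBox K)

theorem setIntegral_closedBox (K : BoxIntegral.Box (Fin d)) (g : EuclideanSpace ℝ (Fin d) → ℝ) :
    ∫ x in closedBox K, g x = ∫ y in Icc K.lower K.upper, g (WithLp.toLp 2 y) := by
  rw [closedBox_eq_preimage, ← (PiLp.volume_preserving_toLp (Fin d)).setIntegral_preimage_emb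
    (MeasurableEquiv.toLp 2 (Fin d → ℝ)).measurableEmbedding]
  rfl

theorem volume_real_closedBox (K : BoxIntegral.Box (Fin d)) :
    (volume : Measure (EuclideanSpace ℝ (Fin d))).real (closedBox K) =
      volume.real (Icc K.lower K.upper) := by
  simpa using setIntegral_closedBox K fun _ => 1

theorem sub_le_diam_closedBox (K : BoxIntegral.Box (Fin d)) (i : Fin d) :
    K.upper i - K.lower i ≤ Metric.diam (closedBox K) := by
  have h1 : WithLp.toLp 2 K.upper ∈ closedBox K := fun i =>
    ⟨(K.lower_lt_upper i).le, le_rfl⟩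
  have h2 : WithLp.toLp 2 K.lower ∈ closedBox K := fun i =>
    ⟨le_rfl, (K.lower_lt_upper i).le⟩
  refine le_trans ?_ (Metric.dist_le_diam_of_mem (isCompact_closedBox K).isBounded h1 h2)
  rw [dist_eq_norm]
  refine le_trans (le_abs_self _) ?_
  simpa using PiLp.norm_apply_le (WithLp.toLp 2 K.upper - WithLp.toLp 2 K.lower) i

end EuclideanBoxes

section Smooth

variable {d : ℕ} {φ : EuclideanSpace ℝ (Fin d) → ℝ}

theorem ContDiff.continuous_gradient (hφ : ContDiff ℝ 1 φ) : Continuous (∇ φ) := by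
  unfold gradient
  exact (LinearIsometryEquiv.continuous _).comp (hφ.continuous_fderiv one_ne_zero)

theorem ContDiff.hasContinuousPartials (hφ : ContDiff ℝ 1 φ) :
    HasContinuousPartials (fun y : Fin d → ℝ => φ (WithLp.toLp 2 y))
      (fun i y => ∇ φ (WithLp.toLp 2 y) i) where
  continuous := hφ.continuous.comp (PiLp.continuous_toLp 2 _)
  continuous_partial i := by
    have := hφ.continuous_gradient.comp (PiLp.continuous_toLp 2 (fun _ : Fin d => ℝ))
    exact (EuclideanSpace.proj (𝕜 := ℝ) i).continuous.comp this
  hasDerivAt y i := by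
    have h1 := ((PiLp.continuousLinearEquiv 2 ℝ (fun _ : Fin d => ℝ)).symm.hasFDerivAt
      (x := Function.update y i (y i))).comp_hasDerivAt (y i) (hasDerivAt_update y i (y i))
    have h2 := ((hφ.differentiable one_ne_zero) ((PiLp.continuousLinearEquiv 2 ℝ
      (fun _ : Fin d => ℝ)).symm (Function.update y i (y i)))).hasFDerivAt.comp_hasDerivAt (y i) h1
    refine h2.congr_deriv ?_
    rw [Function.update_eq_self]
    change fderiv ℝ φ (WithLp.toLp 2 y) (EuclideanSpace.single i 1) = _
    rw [← inner_gradient_left, EuclideanSpace.inner_single_right]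
    simp

/-- The Poincaré inequality on a hyperrectangle for smooth functions. -/
theorem ContDiff.variance_closedBox_le (hφ : ContDiff ℝ 1 φ) (K : BoxIntegral.Box (Fin d)) :
    volume.real (closedBox K) * (∫ x in closedBox K, φ x ^ 2) - (∫ x in closedBox K, φ x) ^ 2 ≤
      volume.real (closedBox K) *
        ((Metric.diam (closedBox K) * Real.pi⁻¹) ^ 2 * ∫ x in closedBox K, ‖∇ φ x‖ ^ 2) := by
  have h := hφ.hasContinuousPartials
  have hi : ∀ i ∈ (Finset.univ : Finset (Fin d)), Integrable
      (fun y : Fin d → ℝ => ∇ φ (WithLp.toLp 2 y) i ^ 2)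
      (volume.restrict (Icc K.lower K.upper)) := fun i _ =>
    ((h.continuous_partial i).fun_pow 2).integrable_restrict_of_isCompact isCompact_Icc
  simp only [setIntegral_closedBox, volume_real_closedBox, EuclideanSpace.real_norm_sq_eq]
  rw [integral_finsetSum _ hi, Finset.mul_sum]
  refine (h.variance_le K.lower_lt_upper).trans ?_
  gcongr with i
  · exact div_nonneg (sub_nonneg.2 (K.lower_lt_upper i).le) Real.pi_pos.le
  · rw [div_eq_mul_inv]
    gcongr
    exact sub_le_diam_closedBox K i

/-- The Friedrichs inequality on a hyperrectangle for smooth functions. -/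
theorem ContDiff.integral_sq_le_poincareConst (hd : 1 ≤ d) (hφ : ContDiff ℝ 1 φ)
    (B : BoxIntegral.Box (Fin d)) (h0 : ∀ x ∉ openBox B, φ x = 0) :
    ∫ x in closedBox B, φ x ^ 2 ≤ poincareConst B ^ 2 * ∫ x in closedBox B, ‖∇ φ x‖ ^ 2 := by
  obtain ⟨n, rfl⟩ : ∃ n, d = n + 1 := ⟨d - 1, by omega⟩
  have h := hφ.hasContinuousPartials
  have hi : ∀ i ∈ (Finset.univ : Finset (Fin (n + 1))), Integrable
      (fun y : Fin (n + 1) → ℝ => ∇ φ (WithLp.toLp 2 y) i ^ 2)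
      (volume.restrict (Icc B.lower B.upper)) := fun i _ =>
    ((h.continuous_partial i).fun_pow 2).integrable_restrict_of_isCompact isCompact_Icc
  simp only [setIntegral_closedBox, EuclideanSpace.real_norm_sq_eq]
  rw [integral_finsetSum _ hi]
  have hL : ∀ i, 0 < B.upper i - B.lower i := fun i => sub_pos.2 (B.lower_lt_upper i)
  set I := ∫ y in Icc B.lower B.upper, φ (WithLp.toLp 2 y) ^ 2
  set J := fun i => ∫ y in Icc B.lower B.upper, ∇ φ (WithLp.toLp 2 y) i ^ 2
  have hdir : ∀ i, ((B.upper i - B.lower i) ^ 2)⁻¹ * I ≤ (Real.pi⁻¹) ^ 2 * J i := by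
    intro i
    have := h.setIntegral_sq_le i (B.lower_lt_upper i)
      (fun x hx => h0 _ fun hmem => by simpa [hx] using (hmem i).1)
      (fun x hx => h0 _ fun hmem => by simpa [hx] using (hmem i).2)
    rw [inv_mul_le_iff₀ (by have := hL i; positivity)]
    refine this.trans (le_of_eq ?_)
    rw [div_eq_mul_inv]
    ring
  set s := ∑ i, ((B.upper i - B.lower i) ^ 2)⁻¹ with hs
  have hspos : 0 < s := Finset.sum_pos (fun i _ => by have := hL i; positivity)
    Finset.univ_nonempty
  have hsum : s * I ≤ (Real.pi⁻¹) ^ 2 * ∑ i, J i := by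
    rw [hs, Finset.sum_mul, Finset.mul_sum]
    exact Finset.sum_le_sum fun i _ => hdir i
  rw [poincareConst, ← hs, mul_pow, inv_pow √s, Real.sq_sqrt hspos.le, mul_right_comm,
    mul_comm _ s⁻¹, le_inv_mul_iff₀ hspos]
  exact hsum

end Smooth

/-! ### Limits in `L²` -/

section Limits

variable {α F : Type*} [MeasurableSpace α] {μ : Measure α} [NormedAddCommGroup F]
  {w : α → F} {φ : ℕ → α → F}

theorem tendsto_toLp_of_tendsto_eLpNorm (hw : MemLp w 2 μ) (hφ : ∀ n, MemLp (φ n) 2 μ)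
    (h : Tendsto (fun n => eLpNorm (fun x => w x - φ n x) 2 μ) atTop (𝓝 0)) :
    Tendsto (fun n => (hφ n).toLp (φ n)) atTop (𝓝 (hw.toLp w)) := by
  rw [Lp.tendsto_Lp_iff_tendsto_eLpNorm'']
  refine h.congr fun n => ?_
  rw [← eLpNorm_neg]
  congr 1
  ext x
  simp

theorem tendsto_toReal_eLpNorm (hw : MemLp w 2 μ) (hφ : ∀ n, MemLp (φ n) 2 μ)
    (h : Tendsto (fun n => eLpNorm (fun x => w x - φ n x) 2 μ) atTop (𝓝 0)) :
    Tendsto (fun n => (eLpNorm (φ n) 2 μ).toReal) atTop (𝓝 (eLpNorm w 2 μ).toReal) := by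
  simpa using (tendsto_toLp_of_tendsto_eLpNorm hw hφ h).norm

theorem tendsto_integral_inner [InnerProductSpace ℝ F] {g : α → F} (hg : MemLp g 2 μ)
    (hw : MemLp w 2 μ) (hφ : ∀ n, MemLp (φ n) 2 μ)
    (h : Tendsto (fun n => eLpNorm (fun x => w x - φ n x) 2 μ) atTop (𝓝 0)) :
    Tendsto (fun n => ∫ x, inner ℝ (g x) (φ n x) ∂μ) atTop (𝓝 (∫ x, inner ℝ (g x) (w x) ∂μ)) := by
  simp_rw [fun n => integral_inner_toLp hg (hφ n), integral_inner_toLp hg hw]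
  exact tendsto_const_nhds.inner (tendsto_toLp_of_tendsto_eLpNorm hw hφ h)

theorem tendsto_integral_mul {g w : α → ℝ} {φ : ℕ → α → ℝ} (hg : MemLp g 2 μ)
    (hw : MemLp w 2 μ) (hφ : ∀ n, MemLp (φ n) 2 μ)
    (h : Tendsto (fun n => eLpNorm (fun x => w x - φ n x) 2 μ) atTop (𝓝 0)) :
    Tendsto (fun n => ∫ x, g x * φ n x ∂μ) atTop (𝓝 (∫ x, g x * w x ∂μ)) := by
  simpa [mul_comm] using tendsto_integral_inner hg hw hφ h

end Limits

/-! ### Weak gradients and divergences -/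

section Sobolev

variable {d : ℕ} {Ω : TopologicalSpace.Opens (EuclideanSpace ℝ (Fin d))}

theorem TestFunction.contDiff_one (φ : 𝓓(Ω, ℝ)) : ContDiff ℝ 1 φ :=
  φ.contDiff.of_le (by exact_mod_cast le_top)

theorem TestFunction.memLp (φ : 𝓓(Ω, ℝ)) (p : ℝ≥0∞)
    (μ : Measure (EuclideanSpace ℝ (Fin d))) [IsFiniteMeasureOnCompacts μ] : MemLp φ p μ :=
  φ.continuous.memLp_of_hasCompactSupport φ.hasCompactSupport

theorem TestFunction.hasCompactSupport_gradient (φ : 𝓓(Ω, ℝ)) : HasCompactSupport (∇ φ) := by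
  have h := φ.hasCompactSupport.fderiv (𝕜 := ℝ)
  exact h.comp_left (g := (InnerProductSpace.toDual ℝ (EuclideanSpace ℝ (Fin d))).symm) (map_zero _)

theorem TestFunction.memLp_gradient (φ : 𝓓(Ω, ℝ)) (p : ℝ≥0∞)
    (μ : Measure (EuclideanSpace ℝ (Fin d))) [IsFiniteMeasureOnCompacts μ] : MemLp (∇ φ) p μ :=
  φ.contDiff_one.continuous_gradient.memLp_of_hasCompactSupport φ.hasCompactSupport_gradient

theorem MeasureTheory.MemLp.euclideanSpace_apply {α : Type*} [MeasurableSpace α] {μ : Measure α}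
    {p : ℝ≥0∞} {g : α → EuclideanSpace ℝ (Fin d)} (hg : MemLp g p μ) (i : Fin d) :
    MemLp (fun x => g x i) p μ :=
  (EuclideanSpace.proj (𝕜 := ℝ) i).comp_memLp' hg

theorem ReactionDiffusion.IsWeakGrad.sub {u v : EuclideanSpace ℝ (Fin d) → ℝ}
    {g h : EuclideanSpace ℝ (Fin d) → EuclideanSpace ℝ (Fin d)}
    (hu : MemLp u 2 (volume.restrict Ω)) (hv : MemLp v 2 (volume.restrict Ω))
    (hg : MemLp g 2 (volume.restrict Ω)) (hh : MemLp h 2 (volume.restrict Ω))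
    (hug : IsWeakGrad Ω u g) (hvh : IsWeakGrad Ω v h) :
    IsWeakGrad Ω (fun x => u x - v x) (fun x => g x - h x) := by
  intro φ i
  have h1 := (φ.memLp_gradient 2 (volume.restrict Ω)).euclideanSpace_apply i
  have h2 := φ.memLp 2 (volume.restrict Ω)
  simp only [sub_mul, PiLp.sub_apply]
  rw [integral_sub (integrable_mul_of_memLp hu h1) (integrable_mul_of_memLp hv h1),
    integral_sub (integrable_mul_of_memLp (hg.euclideanSpace_apply i) h2)
      (integrable_mul_of_memLp (hh.euclideanSpace_apply i) h2), hug φ i, hvh φ i]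
  ring

/-- Uniqueness of the weak gradient, by the fundamental lemma of the calculus of variations. -/
theorem ReactionDiffusion.IsWeakGrad.ae_eq {u : EuclideanSpace ℝ (Fin d) → ℝ}
    {g h : EuclideanSpace ℝ (Fin d) → EuclideanSpace ℝ (Fin d)}
    (hg : MemLp g 2 (volume.restrict Ω)) (hh : MemLp h 2 (volume.restrict Ω))
    (hug : IsWeakGrad Ω u g) (huh : IsWeakGrad Ω u h) : g =ᵐ[volume.restrict Ω] h := by
  have key : ∀ i, ∀ᵐ x, x ∈ (Ω : Set (EuclideanSpace ℝ (Fin d))) → g x i - h x i = 0 := by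
    intro i
    have hgi := hg.euclideanSpace_apply i
    have hhi := hh.euclideanSpace_apply i
    refine Ω.isOpen.ae_eq_zero_of_integral_contDiff_smul_eq_zero ?_ fun ψ hψ hψc hψs => ?_
    · exact (locallyIntegrableOn_of_locallyIntegrable_restrict
        ((hgi.sub hhi).locallyIntegrable one_le_two))
    · set φ : 𝓓(Ω, ℝ) := ⟨ψ, hψ, hψc, hψs⟩
      have hφ := φ.memLp 2 (volume.restrict Ω)
      rw [← setIntegral_eq_integral_of_forall_compl_eq_zero (s := Ω)
        fun x hx => by rw [image_eq_zero_of_notMem_tsupport fun h => hx (hψs h), zero_smul]]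
      have e1 := hug φ i
      rw [huh φ i, neg_inj] at e1
      calc ∫ x in Ω, ψ x • (g x i - h x i) = ∫ x in Ω, (g x i * φ x - h x i * φ x) := by
            refine integral_congr_ae (Eventually.of_forall fun x => ?_)
            change ψ x * (g x i - h x i) = g x i * ψ x - h x i * ψ x
            ring
        _ = 0 := by
            rw [integral_sub (integrable_mul_of_memLp hgi hφ) (integrable_mul_of_memLp hhi hφ), e1,
              sub_self]
  rw [EventuallyEq, ae_restrict_iff' Ω.isOpen.measurableSet]
  filter_upwards [ae_all_iff.2 key] with x hx hxΩ
  ext i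
  exact sub_eq_zero.1 (hx i hxΩ)

theorem ReactionDiffusion.MemH1.weakGrad_spec {u : EuclideanSpace ℝ (Fin d) → ℝ} (hu : MemH1 Ω u) :
    MemLp (weakGrad Ω u) 2 (volume.restrict Ω) ∧ IsWeakGrad Ω u (weakGrad Ω u) := by
  rw [weakGrad, dif_pos hu.2]
  exact hu.2.choose_spec

theorem ReactionDiffusion.MemHdiv.weakDiv_spec {τ : EuclideanSpace ℝ (Fin d) → EuclideanSpace ℝ (Fin d)}
    (hτ : MemHdiv Ω τ) :
    MemLp (weakDiv Ω τ) 2 (volume.restrict Ω) ∧ IsWeakDiv Ω τ (weakDiv Ω τ) := by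
  rw [weakDiv, dif_pos hτ.2]
  exact hτ.2.choose_spec

theorem ReactionDiffusion.MemH1.sub {u v : EuclideanSpace ℝ (Fin d) → ℝ} (hu : MemH1 Ω u) (hv : MemH1 Ω v) :
    MemH1 Ω fun x => u x - v x :=
  ⟨hu.1.sub hv.1, _, hu.weakGrad_spec.1.sub hv.weakGrad_spec.1,
    hu.weakGrad_spec.2.sub hu.1 hv.1 hu.weakGrad_spec.1 hv.weakGrad_spec.1 hv.weakGrad_spec.2⟩

theorem ReactionDiffusion.MemH1.weakGrad_sub {u v : EuclideanSpace ℝ (Fin d) → ℝ} (hu : MemH1 Ω u)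
    (hv : MemH1 Ω v) :
    weakGrad Ω (fun x => u x - v x) =ᵐ[volume.restrict Ω]
      fun x => weakGrad Ω u x - weakGrad Ω v x :=
  IsWeakGrad.ae_eq (hu.sub hv).weakGrad_spec.1 (hu.weakGrad_spec.1.sub hv.weakGrad_spec.1)
    (hu.sub hv).weakGrad_spec.2
    (hu.weakGrad_spec.2.sub hu.1 hv.1 hu.weakGrad_spec.1 hv.weakGrad_spec.1 hv.weakGrad_spec.2)

theorem TestFunction.gradient_sub (φ ψ : 𝓓(Ω, ℝ)) (x : EuclideanSpace ℝ (Fin d)) :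
    ∇ (φ - ψ : 𝓓(Ω, ℝ)) x = ∇ φ x - ∇ ψ x := by
  have h1 := (φ.contDiff_one.differentiable one_ne_zero) x
  have h2 := (ψ.contDiff_one.differentiable one_ne_zero) x
  simp only [gradient]
  rw [← map_sub, ← fderiv_sub h1 h2]
  rfl

theorem ReactionDiffusion.MemH10.sub {u v : EuclideanSpace ℝ (Fin d) → ℝ} (hu : MemH10 Ω u) (hv : MemH10 Ω v) :
    MemH10 Ω fun x => u x - v x := by
  obtain ⟨hu1, φ, hφ, hφ'⟩ := hu
  obtain ⟨hv1, ψ, hψ, hψ'⟩ := hv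
  refine ⟨hu1.sub hv1, fun n => φ n - ψ n, ?_, ?_⟩
  · refine tendsto_of_tendsto_of_tendsto_of_le_of_le tendsto_const_nhds
      (by simpa using hφ.add hψ) (fun n => zero_le) fun n => ?_
    have hmφ := (φ n).memLp 2 (volume.restrict Ω)
    have hmψ := (ψ n).memLp 2 (volume.restrict Ω)
    refine le_trans (le_of_eq ?_) (eLpNorm_sub_le (hu1.1.sub hmφ).1 (hv1.1.sub hmψ).1 one_le_two)
    congr 1
    ext x
    change u x - v x - (φ n x - ψ n x) = (u x - φ n x) - (v x - ψ n x)
    ring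
  · refine tendsto_of_tendsto_of_tendsto_of_le_of_le tendsto_const_nhds
      (by simpa using hφ'.add hψ') (fun n => zero_le) fun n => ?_
    have hmφ := (φ n).memLp_gradient 2 (volume.restrict Ω)
    have hmψ := (ψ n).memLp_gradient 2 (volume.restrict Ω)
    refine le_trans (le_of_eq ?_) (eLpNorm_sub_le (hu1.weakGrad_spec.1.sub hmφ).1
      (hv1.weakGrad_spec.1.sub hmψ).1 one_le_two)
    apply eLpNorm_congr_ae
    filter_upwards [hu1.weakGrad_sub hv1] with x hx
    rw [hx, TestFunction.gradient_sub]
    simp only [Pi.sub_apply]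
    abel

/-- Integration by parts against functions in `H¹₀(Ω)`. -/
theorem ReactionDiffusion.MemHdiv.integral_inner_weakGrad
    {τ : EuclideanSpace ℝ (Fin d) → EuclideanSpace ℝ (Fin d)} {v : EuclideanSpace ℝ (Fin d) → ℝ}
    (hτ : MemHdiv Ω τ) (hv : MemH10 Ω v) :
    ∫ x in Ω, inner ℝ (τ x) (weakGrad Ω v x) = -∫ x in Ω, weakDiv Ω τ x * v x := by
  obtain ⟨hv1, φ, hφ, hφ'⟩ := hv
  have h1 := tendsto_integral_inner hτ.1 hv1.weakGrad_spec.1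
    (fun n => (φ n).memLp_gradient 2 (volume.restrict Ω)) hφ'
  have h2 := tendsto_integral_mul hτ.weakDiv_spec.1 hv1.1
    (fun n => (φ n).memLp 2 (volume.restrict Ω)) hφ
  refine tendsto_nhds_unique h1 (h2.neg.congr fun n => ?_)
  exact (hτ.weakDiv_spec.2 (φ n)).symm

end Sobolev

/-! ### Poincaré inequalities in `H¹₀` -/

section Poincare

variable {d : ℕ} {B K : BoxIntegral.Box (Fin d)} {v : EuclideanSpace ℝ (Fin d) → ℝ}

theorem poincareConst_nonneg (B : BoxIntegral.Box (Fin d)) : 0 ≤ poincareConst B := by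
  have := Real.pi_pos
  unfold poincareConst
  positivity

theorem ReactionDiffusion.MemH10.l2Norm_le (hd : 1 ≤ d) (hv : MemH10 (openBox B) v) :
    l2Norm (openBox B : Set _) v ≤
      poincareConst B * l2Norm (openBox B : Set _) (weakGrad (openBox B) v) := by
  obtain ⟨hv1, φ, hφ, hφ'⟩ := hv
  have m1 := fun n => (φ n).memLp 2 (volume.restrict (openBox B))
  have m2 := fun n => (φ n).memLp_gradient 2 (volume.restrict (openBox B))
  refine le_of_tendsto_of_tendsto' (tendsto_toReal_eLpNorm hv1.1 m1 hφ)
    ((tendsto_toReal_eLpNorm hv1.weakGrad_spec.1 m2 hφ').const_mul _) fun n => ?_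
  refine le_of_sq_le_sq ?_ (mul_nonneg (poincareConst_nonneg B) ENNReal.toReal_nonneg)
  rw [mul_pow, toReal_eLpNorm_sq (m1 n), toReal_eLpNorm_sq (m2 n), restrict_openBox]
  simpa using (φ n).contDiff_one.integral_sq_le_poincareConst hd B fun x hx =>
    image_eq_zero_of_notMem_tsupport fun h => hx ((φ n).tsupport_subset h)

theorem restrict_closedBox_le (hK : closedBox K ⊆ closedBox B) :
    (volume : Measure (EuclideanSpace ℝ (Fin d))).restrict (closedBox K) ≤
      volume.restrict (openBox B) := by
  rw [restrict_openBox]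
  exact Measure.restrict_mono hK le_rfl

/-- The Poincaré inequality on a subbox `K`, tested against functions of mean value zero. -/
theorem ReactionDiffusion.MemH10.abs_integral_mul_le (hv : MemH10 (openBox B) v) (hK : closedBox K ⊆ closedBox B)
    {g : EuclideanSpace ℝ (Fin d) → ℝ} (hg : MemLp g 2 (volume.restrict (closedBox K)))
    (hg0 : ∫ x in closedBox K, g x = 0) :
    |∫ x in closedBox K, g x * v x| ≤
      Metric.diam (closedBox K) * Real.pi⁻¹ * l2Norm (closedBox K) g *
        l2Norm (closedBox K) (weakGrad (openBox B) v) := by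
  obtain ⟨hv1, φ, hφ, hφ'⟩ := hv
  have hle := restrict_closedBox_le hK
  have m1 := fun n => (φ n).memLp 2 (volume.restrict (closedBox K))
  have m2 := fun n => (φ n).memLp_gradient 2 (volume.restrict (closedBox K))
  have mono : ∀ {F : Type} [NormedAddCommGroup F] {w : ℕ → EuclideanSpace ℝ (Fin d) → F},
      Tendsto (fun n => eLpNorm (w n) 2 (volume.restrict (openBox B))) atTop (𝓝 0) →
      Tendsto (fun n => eLpNorm (w n) 2 (volume.restrict (closedBox K))) atTop (𝓝 0) :=
    fun h => tendsto_of_tendsto_of_tendsto_of_le_of_le tendsto_const_nhds h (fun n => zero_le)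
      fun n => eLpNorm_mono_measure _ hle
  -- It suffices to treat the test functions that approximate `v`.
  refine le_of_tendsto_of_tendsto'
    (tendsto_integral_mul hg (hv1.1.mono_measure hle) m1 (mono hφ)).abs
    ((tendsto_toReal_eLpNorm (hv1.weakGrad_spec.1.mono_measure hle) m2 (mono hφ')).const_mul _)
    fun n => ?_
  have : IsFiniteMeasure (volume.restrict (closedBox K)) :=
    ⟨by simpa using (isCompact_closedBox K).measure_lt_top⟩
  set V := volume.real (closedBox K) with hV
  have hV' : (volume.restrict (closedBox K)).real univ = V := by simp [hV]
  have hVpos : 0 < V := by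
    rw [hV, volume_real_closedBox]
    exact volume_real_Icc_pos K.lower_lt_upper
  set m := ∫ x in closedBox K, φ n x
  -- Since `g` has mean value zero, the mean value `m / V` of the test function can be subtracted.
  have h1 : V * ∫ x in closedBox K, g x * φ n x =
      ∫ x in closedBox K, g x * (V * φ n x - m) := by
    have : ∀ x, g x * (V * φ n x - m) = V * (g x * φ n x) - m * g x := fun x => by ring
    simp_rw [this]
    rw [integral_sub ((integrable_mul_of_memLp hg (m1 n)).const_mul _)
      ((hg.integrable one_le_two).const_mul _), integral_const_mul, integral_const_mul, hg0]
    ring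
  have m3 : MemLp (fun x => V * φ n x - m) 2 (volume.restrict (closedBox K)) :=
    ((m1 n).const_mul _).sub (memLp_const _)
  have h2 : (eLpNorm (fun x => V * φ n x - m) 2 (volume.restrict (closedBox K))).toReal ≤
      V * (Metric.diam (closedBox K) * Real.pi⁻¹ *
        (eLpNorm (∇ (φ n)) 2 (volume.restrict (closedBox K))).toReal) := by
    have hd0 : 0 ≤ Metric.diam (closedBox K) := Metric.diam_nonneg
    have := Real.pi_pos
    refine le_of_sq_le_sq ?_ (by positivity)
    have e := integral_mul_sub_integral_sq (m1 n)
    rw [hV'] at e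
    rw [toReal_eLpNorm_sq m3, mul_pow, mul_pow, toReal_eLpNorm_sq (m2 n)]
    simp only [Real.norm_eq_abs, sq_abs]
    rw [e, sq V, mul_assoc]
    exact mul_le_mul_of_nonneg_left ((φ n).contDiff_one.variance_closedBox_le K) hVpos.le
  refine le_of_mul_le_mul_left ?_ hVpos
  calc V * |∫ x in closedBox K, g x * φ n x| = |∫ x in closedBox K, g x * (V * φ n x - m)| := by
        rw [← h1, abs_mul, abs_of_pos hVpos]
    _ ≤ l2Norm (closedBox K) g * _ := _root_.abs_integral_mul_le hg m3
    _ ≤ l2Norm (closedBox K) g * (V * (Metric.diam (closedBox K) * Real.pi⁻¹ *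
        (eLpNorm (∇ (φ n)) 2 (volume.restrict (closedBox K))).toReal)) :=
      mul_le_mul_of_nonneg_left h2 ENNReal.toReal_nonneg
    _ = _ := by ring

end Poincare

/-! ### Decomposition over the mesh -/

section Mesh

variable {d : ℕ} {B : BoxIntegral.Box (Fin d)} {𝒯 : Finset (BoxIntegral.Box (Fin d))}

theorem ReactionDiffusion.IsMesh.subset (h : IsMesh B 𝒯) {K : BoxIntegral.Box (Fin d)}
    (hK : K ∈ 𝒯) : closedBox K ⊆ closedBox B := by
  rw [← h.cover]
  exact subset_biUnion_of_mem (u := fun K : BoxIntegral.Box (Fin d) => closedBox K) hK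

theorem ReactionDiffusion.IsMesh.setIntegral_eq_sum (h : IsMesh B 𝒯)
    {F : EuclideanSpace ℝ (Fin d) → ℝ} (hF : Integrable F (volume.restrict (openBox B))) :
    ∫ x in openBox B, F x = ∑ K ∈ 𝒯, ∫ x in closedBox K, F x := by
  have hae : (⋃ K ∈ 𝒯, (openBox K : Set (EuclideanSpace ℝ (Fin d)))) =ᵐ[volume]
      ⋃ K ∈ 𝒯, closedBox K := by
    refine Filter.EventuallyEq.countable_bUnion (Finset.countable_toSet 𝒯) fun K _ => ?_
    exact openBox_ae_eq_closedBox K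
  rw [restrict_openBox, ← h.cover, ← setIntegral_congr_set hae,
    integral_biUnion_finset 𝒯 (fun K _ => (openBox K).isOpen.measurableSet)
      (fun K hK K' hK' hne => h.disjoint_interiors K hK K' hK' hne)]
  · exact Finset.sum_congr rfl fun K _ => by rw [restrict_openBox]
  · intro K hK
    rw [IntegrableOn, restrict_openBox]
    exact hF.mono_measure (restrict_closedBox_le (h.subset hK))

theorem ReactionDiffusion.IsMesh.l2Norm_sq_eq_sum (h : IsMesh B 𝒯) {F : Type*}
    [NormedAddCommGroup F] {w : EuclideanSpace ℝ (Fin d) → F}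
    (hw : MemLp w 2 (volume.restrict (openBox B))) :
    l2Norm (openBox B : Set _) w ^ 2 = ∑ K ∈ 𝒯, l2Norm (closedBox K) w ^ 2 := by
  unfold l2Norm
  rw [toReal_eLpNorm_sq hw, h.setIntegral_eq_sum hw.norm.integrable_sq]
  exact Finset.sum_congr rfl fun K hK =>
    (toReal_eLpNorm_sq (hw.mono_measure (restrict_closedBox_le (h.subset hK)))).symm

end Mesh

/-! ### The projection and the oscillation term -/

section Oscillation

variable {d : ℕ} {B K : BoxIntegral.Box (Fin d)}

theorem memLp_projQ1 {w : EuclideanSpace ℝ (Fin d) → ℝ}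
    (hw : MemLp w 2 (volume.restrict (closedBox K))) :
    MemLp (projQ1 K w) 2 (volume.restrict (closedBox K)) := by
  rw [projQ1, dif_pos hw]
  exact Lp.memLp _

/-- Constants belong to `ℚ_{1,…,1}(K)`, so the projection error has mean value zero. -/
theorem setIntegral_sub_projQ1 {w : EuclideanSpace ℝ (Fin d) → ℝ}
    (hw : MemLp w 2 (volume.restrict (closedBox K))) :
    ∫ x in closedBox K, (w x - projQ1 K w x) = 0 := by
  have h := (spaceQ1 K).sub_starProjection_mem_orthogonal (hw.toLp w)
  have h1 := (Submodule.mem_orthogonal _ _).1 h ((memLp_monomialQ1 K ∅).toLp (monomialQ1 ∅))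
    (Submodule.subset_span ⟨∅, rfl⟩)
  rw [L2.inner_def] at h1
  rw [← h1]
  apply integral_congr_ae
  filter_upwards [(memLp_monomialQ1 K ∅).coeFn_toLp, hw.coeFn_toLp,
    Lp.coeFn_sub (hw.toLp w) ((spaceQ1 K).starProjection (hw.toLp w))] with x e1 e2 e3
  rw [e1, e3, projQ1, dif_pos hw, Pi.sub_apply, e2]
  simp [monomialQ1]

/-- The Cauchy–Schwarz inequality with weight `κ`, in which the quotient `|g| / κ` is infinite where
`κ = 0 ≠ g`. -/
theorem abs_integral_mul_le_weighted {α : Type*} [MeasurableSpace α] {μ : Measure α}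
    {g κ v : α → ℝ} (hg : AEStronglyMeasurable g μ) (hκ : AEStronglyMeasurable κ μ)
    (hκ0 : ∀ᵐ x ∂μ, 0 ≤ κ x) (hv : MemLp (fun x => κ x * v x) 2 μ)
    (hfin : eLpNorm (fun x => ‖g x‖ₑ / ENNReal.ofReal (κ x)) 2 μ ≠ ∞) :
    |∫ x, g x * v x ∂μ| ≤ (eLpNorm (fun x => ‖g x‖ₑ / ENNReal.ofReal (κ x)) 2 μ).toReal *
      (eLpNorm (fun x => κ x * v x) 2 μ).toReal := by
  have hgm : AEMeasurable (fun x => ‖g x‖ₑ / ENNReal.ofReal (κ x)) μ :=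
    hg.enorm.div hκ.aemeasurable.ennreal_ofReal
  have hlt : ∀ᵐ x ∂μ, ‖g x‖ₑ / ENNReal.ofReal (κ x) < ∞ := by
    have h1 := lintegral_rpow_enorm_lt_top_of_eLpNorm_lt_top two_ne_zero ENNReal.ofNat_ne_top
      hfin.lt_top
    filter_upwards [ae_lt_top' (hgm.enorm.pow_const _) h1.ne] with x hx
    simpa using hx
  -- A finite norm excludes the points where the quotient is infinite, so the real quotient `g / κ`,
  -- which is `0` where `κ = 0`, may be used instead.
  have hz : ∀ᵐ x ∂μ, κ x = 0 → g x = 0 := by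
    filter_upwards [hlt] with x hx hκx
    by_contra hne
    rw [hκx, ENNReal.ofReal_zero, ENNReal.div_zero (by simpa using hne)] at hx
    exact lt_irrefl _ hx
  have hle : eLpNorm (fun x => g x / κ x) 2 μ ≤
      eLpNorm (fun x => ‖g x‖ₑ / ENNReal.ofReal (κ x)) 2 μ := by
    refine eLpNorm_mono_enorm_ae ?_
    filter_upwards [hκ0] with x hx
    rcases hx.eq_or_lt with h0 | h0
    · simp [← h0]
    · rw [enorm_eq_self, div_eq_mul_inv, enorm_mul, enorm_inv h0.ne', div_eq_mul_inv,
        Real.enorm_of_nonneg hx]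
  have hq : MemLp (fun x => g x / κ x) 2 μ :=
    ⟨(hg.aemeasurable.div hκ.aemeasurable).aestronglyMeasurable, hle.trans_lt hfin.lt_top⟩
  have heq : ∫ x, g x * v x ∂μ = ∫ x, g x / κ x * (κ x * v x) ∂μ := by
    apply integral_congr_ae
    filter_upwards [hz] with x hx
    by_cases h0 : κ x = 0
    · simp [h0, hx h0]
    · field_simp
  rw [heq]
  refine (abs_integral_mul_le hq hv).trans ?_
  gcongr

/-- Each of the two quantities in the definition of `osc` bounds the functional `(r - Π_K r, ·)_K`:
one by the Poincaré inequality, since `r - Π_K r` has mean value zero, the other by the weighted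
Cauchy–Schwarz inequality. -/
theorem abs_integral_sub_projQ1_mul_le {κ r v : EuclideanSpace ℝ (Fin d) → ℝ}
    (hK : closedBox K ⊆ closedBox B) (hv : MemH10 (openBox B) v)
    (hr : MemLp r 2 (volume.restrict (closedBox K)))
    (hκ : AEStronglyMeasurable κ (volume.restrict (closedBox K)))
    (hκ0 : ∀ᵐ x ∂(volume.restrict (closedBox K)), 0 ≤ κ x)
    (hκv : MemLp (fun x => κ x * v x) 2 (volume.restrict (closedBox K))) :
    |∫ x in closedBox K, (r x - projQ1 K r x) * v x| ≤
      osc K κ r * √(l2Norm (closedBox K) (weakGrad (openBox B) v) ^ 2 +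
        l2Norm (closedBox K) (fun x => κ x * v x) ^ 2) := by
  have hg : MemLp (fun x => r x - projQ1 K r x) 2 (volume.restrict (closedBox K)) :=
    hr.sub (memLp_projQ1 hr)
  set G := l2Norm (closedBox K) (weakGrad (openBox B) v)
  set N := l2Norm (closedBox K) (fun x => κ x * v x)
  have hG : G ≤ √(G ^ 2 + N ^ 2) := Real.le_sqrt_of_sq_le (by nlinarith [sq_nonneg N])
  have hN : N ≤ √(G ^ 2 + N ^ 2) := Real.le_sqrt_of_sq_le (by nlinarith [sq_nonneg G])
  rw [osc]
  rcases min_cases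
    (ENNReal.ofReal (Metric.diam (closedBox K) * Real.pi⁻¹) *
      eLpNorm (fun x => r x - projQ1 K r x) 2 (volume.restrict (closedBox K)))
    (eLpNorm (fun x => ‖r x - projQ1 K r x‖ₑ / ENNReal.ofReal (κ x)) 2
      (volume.restrict (closedBox K))) with ⟨h, -⟩ | ⟨h, hlt⟩
  · rw [h, ENNReal.toReal_mul, ENNReal.toReal_ofReal
      (mul_nonneg Metric.diam_nonneg (inv_nonneg.2 Real.pi_pos.le))]
    refine (hv.abs_integral_mul_le hK hg (setIntegral_sub_projQ1 hr)).trans ?_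
    refine mul_le_mul_of_nonneg_left hG (mul_nonneg ?_ ENNReal.toReal_nonneg)
    exact mul_nonneg Metric.diam_nonneg (inv_nonneg.2 Real.pi_pos.le)
  · rw [h]
    refine (abs_integral_mul_le_weighted hg.1 hκ hκ0 hκv hlt.ne_top).trans ?_
    exact mul_le_mul_of_nonneg_left hN ENNReal.toReal_nonneg

end Oscillation

/-! ### The error bound -/

section ErrorBound

variable {d : ℕ} {B K : BoxIntegral.Box (Fin d)} {κ f u uh : EuclideanSpace ℝ (Fin d) → ℝ}
  {τ : EuclideanSpace ℝ (Fin d) → EuclideanSpace ℝ (Fin d)}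

theorem MeasureTheory.MemLp.fun_mul_of_top {α : Type*} [MeasurableSpace α] {μ : Measure α}
    {κ v : α → ℝ} (hκ : MemLp κ ∞ μ) (hv : MemLp v 2 μ) : MemLp (fun x => κ x * v x) 2 μ :=
  hv.mul hκ

theorem memLp_sq_mul {α : Type*} [MeasurableSpace α] {μ : Measure α}
    {κ v : α → ℝ} (hκ : MemLp κ ∞ μ) (hv : MemLp v 2 μ) : MemLp (fun x => κ x ^ 2 * v x) 2 μ := by
  simpa only [sq, mul_assoc] using hκ.fun_mul_of_top (hκ.fun_mul_of_top hv)

/-- The error equation: testing the weak formulation with the error `e = u - u_h` and integrating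
`(τ, ∇e)` by parts. -/
theorem energyNorm_sq_eq (hκ : MemLp κ ∞ (volume.restrict (openBox B)))
    (hf : MemLp f 2 (volume.restrict (openBox B))) (hu : IsWeakSolution (openBox B) κ f u)
    (huh : MemH10 (openBox B) uh) (hτ : MemHdiv (openBox B) τ) :
    energyNorm (openBox B) κ (fun x => u x - uh x) ^ 2 =
      (∫ x in openBox B, (resid κ f uh x + weakDiv (openBox B) τ x) * (u x - uh x)) +
      ∫ x in openBox B, inner ℝ (τ x - weakGrad (openBox B) uh x)
        (weakGrad (openBox B) (fun x => u x - uh x) x) := by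
  have he : MemH10 (openBox B) fun x => u x - uh x := hu.1.sub huh
  have hGu := hu.1.1.weakGrad_spec.1
  have hGuh := huh.1.weakGrad_spec.1
  have hGe := he.1.weakGrad_spec.1
  have hκe := hκ.fun_mul_of_top he.1.1
  have hκu := memLp_sq_mul hκ hu.1.1.1
  have hκuh := memLp_sq_mul hκ huh.1.1
  have hδ := hτ.weakDiv_spec.1
  have hsol := hu.2 _ he
  have hparts := hτ.integral_inner_weakGrad he
  set e := fun x => u x - uh x with hedef
  set Ge := weakGrad (openBox B) e
  have h1 : l2Norm (openBox B : Set _) Ge ^ 2 =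
      (∫ x in openBox B, inner ℝ (weakGrad (openBox B) u x) (Ge x)) -
        ∫ x in openBox B, inner ℝ (weakGrad (openBox B) uh x) (Ge x) := by
    rw [l2Norm, toReal_eLpNorm_sq hGe, ← integral_sub (integrable_inner_of_memLp hGu hGe)
      (integrable_inner_of_memLp hGuh hGe)]
    apply integral_congr_ae
    filter_upwards [hu.1.1.weakGrad_sub huh.1] with x hx
    rw [← inner_sub_left, ← hx, real_inner_self_eq_norm_sq]
  have h2 : l2Norm (openBox B : Set _) (fun x => κ x * e x) ^ 2 =
      (∫ x in openBox B, κ x ^ 2 * u x * e x) - ∫ x in openBox B, κ x ^ 2 * uh x * e x := by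
    rw [l2Norm, toReal_eLpNorm_sq hκe, ← integral_sub (integrable_mul_of_memLp hκu he.1.1)
      (integrable_mul_of_memLp hκuh he.1.1)]
    refine integral_congr_ae (Eventually.of_forall fun x => ?_)
    simp only [Real.norm_eq_abs, sq_abs, hedef]
    ring
  have h3 : ∫ x in openBox B, (resid κ f uh x + weakDiv (openBox B) τ x) * e x =
      (∫ x in openBox B, f x * e x) - (∫ x in openBox B, κ x ^ 2 * uh x * e x) +
        ∫ x in openBox B, weakDiv (openBox B) τ x * e x := by
    have i1 := integrable_mul_of_memLp hf he.1.1
    have i2 := integrable_mul_of_memLp hκuh he.1.1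
    have i12 : Integrable (fun x => f x * e x - κ x ^ 2 * uh x * e x)
        (volume.restrict (openBox B)) := i1.sub i2
    rw [← integral_sub i1 i2, ← integral_add i12 (integrable_mul_of_memLp hδ he.1.1)]
    refine integral_congr_ae (Eventually.of_forall fun x => ?_)
    simp only [resid]
    ring
  have h4 : ∫ x in openBox B, inner ℝ (τ x - weakGrad (openBox B) uh x) (Ge x) =
      (∫ x in openBox B, inner ℝ (τ x) (Ge x)) -
        ∫ x in openBox B, inner ℝ (weakGrad (openBox B) uh x) (Ge x) := by
    simp only [inner_sub_left]
    exact integral_sub (integrable_inner_of_memLp hτ.1 hGe) (integrable_inner_of_memLp hGuh hGe)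
  rw [energyNorm, Real.sq_sqrt (by positivity), h1, h2, h3, h4, hparts]
  linarith

/-- The contribution of one element to the right-hand side of the error equation. -/
theorem local_error_bound {κ₀ c : ℝ} (hκ₀ : 0 ≤ κ₀) (hc : 0 < c)
    (hK : closedBox K ⊆ closedBox B) {e : EuclideanSpace ℝ (Fin d) → ℝ}
    (hκ : MemLp κ ∞ (volume.restrict (closedBox K)))
    (hκ_nonneg : ∀ᵐ x ∂(volume.restrict (closedBox K)), 0 ≤ κ x)
    (hκc : ∀ᵐ x ∂(volume.restrict (closedBox K)), c ≤ κ x + κ₀)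
    (hr : MemLp (resid κ f uh) 2 (volume.restrict (closedBox K)))
    (he : MemH10 (openBox B) e) (huh : MemH10 (openBox B) uh) (hτ : MemHdiv (openBox B) τ) :
    (∫ x in closedBox K, (resid κ f uh x + weakDiv (openBox B) τ x) * e x) +
      (∫ x in closedBox K, inner ℝ (τ x - weakGrad (openBox B) uh x)
        (weakGrad (openBox B) e x)) ≤
    (localEta (openBox B) K κ f uh κ₀ τ + osc K κ (resid κ f uh)) *
      √(l2Norm (closedBox K) (weakGrad (openBox B) e) ^ 2 +
        l2Norm (closedBox K) (fun x => κ x * e x) ^ 2) +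
    κ₀ * (residNorm (openBox B) K κ (resid κ f uh) κ₀ τ * l2Norm (closedBox K) e) := by
  have hle := restrict_closedBox_le hK
  set μ := volume.restrict (closedBox K)
  set r := resid κ f uh
  set δ := weakDiv (openBox B) τ
  have he' : MemLp e 2 μ := he.1.1.mono_measure hle
  have hGe : MemLp (weakGrad (openBox B) e) 2 μ := he.1.weakGrad_spec.1.mono_measure hle
  have hδ : MemLp δ 2 μ := hτ.weakDiv_spec.1.mono_measure hle
  have hσ : MemLp (fun x => τ x - weakGrad (openBox B) uh x) 2 μ :=
    (hτ.1.sub huh.1.weakGrad_spec.1).mono_measure hle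
  have hκe : MemLp (fun x => κ x * e x) 2 μ := hκ.fun_mul_of_top he'
  have hP : MemLp (fun x => projQ1 K r x + δ x) 2 μ := (memLp_projQ1 hr).add hδ
  have hinv : MemLp (fun x => (κ x + κ₀)⁻¹) ∞ μ := by
    refine memLp_top_of_bound
      (hκ.1.add aestronglyMeasurable_const).aemeasurable.inv.aestronglyMeasurable c⁻¹ ?_
    filter_upwards [hκc] with x hx
    rw [Real.norm_eq_abs, abs_inv, abs_of_pos (hc.trans_le hx)]
    exact inv_anti₀ hc hx
  have hw : MemLp (fun x => (κ x + κ₀)⁻¹ * (projQ1 K r x + δ x)) 2 μ := hinv.fun_mul_of_top hP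
  set w := fun x => (κ x + κ₀)⁻¹ * (projQ1 K r x + δ x) with hwdef
  have hsplit : ∫ x, (r x + δ x) * e x ∂μ = (∫ x, w x * (κ x * e x) ∂μ) +
      κ₀ * (∫ x, w x * e x ∂μ) + ∫ x, (r x - projQ1 K r x) * e x ∂μ := by
    have i1 := integrable_mul_of_memLp hw hκe
    have i2 := (integrable_mul_of_memLp hw he').const_mul κ₀
    have i12 : Integrable (fun x => w x * (κ x * e x) + κ₀ * (w x * e x)) μ := i1.add i2
    have i3 : Integrable (fun x => (r x - projQ1 K r x) * e x) μ :=
      integrable_mul_of_memLp (hr.sub (memLp_projQ1 hr)) he'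
    rw [← integral_const_mul, ← integral_add i1 i2, ← integral_add i12 i3]
    apply integral_congr_ae
    filter_upwards [hκc] with x hx
    have hne : κ x + κ₀ ≠ 0 := (hc.trans_le hx).ne'
    simp only [hwdef]
    field_simp
    ring
  have b1 := (le_abs_self _).trans (abs_integral_mul_le hw hκe)
  have b2 := (le_abs_self _).trans (abs_integral_mul_le hw he')
  have b3 := (le_abs_self _).trans
    (abs_integral_sub_projQ1_mul_le hK he hr hκ.1 hκ_nonneg hκe)
  have b4 := (le_abs_self _).trans (abs_integral_inner_le hσ hGe)
  rw [hsplit]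
  set G := l2Norm (closedBox K) (weakGrad (openBox B) e) with hG
  set N := l2Norm (closedBox K) (fun x => κ x * e x) with hN
  set ρ := residNorm (openBox B) K κ r κ₀ τ with hρ
  set t := l2Norm (closedBox K) (fun x => τ x - weakGrad (openBox B) uh x) with ht
  -- Cauchy–Schwarz in `ℝ²` combines the flux and the residual terms.
  have hCS : ρ * N + t * G ≤ √(t ^ 2 + ρ ^ 2) * √(G ^ 2 + N ^ 2) := by
    rw [← Real.sqrt_mul (by positivity)]
    refine Real.le_sqrt_of_sq_le ?_
    nlinarith [sq_nonneg (ρ * G - t * N)]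
  have hb1 : ∫ x, w x * (κ x * e x) ∂μ ≤ ρ * N := b1
  have hb2 : κ₀ * ∫ x, w x * e x ∂μ ≤ κ₀ * (ρ * l2Norm (closedBox K) e) :=
    mul_le_mul_of_nonneg_left b2 hκ₀
  have hb4 : ∫ x, inner ℝ (τ x - weakGrad (openBox B) uh x) (weakGrad (openBox B) e x) ∂μ ≤
      t * G := b4
  have hη : localEta (openBox B) K κ f uh κ₀ τ = √(t ^ 2 + ρ ^ 2) := rfl
  rw [hη, add_mul]
  linarith

/-- The error bound, under the assumption that `κ + κ₀` is bounded below by a positive constant. -/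
theorem energyNorm_sub_le (hd : 1 ≤ d) {𝒯 : Finset (BoxIntegral.Box (Fin d))} (h𝒯 : IsMesh B 𝒯)
    (hκ : MemLp κ ∞ (volume.restrict (openBox B)))
    (hκ_nonneg : ∀ᵐ x ∂(volume.restrict (openBox B)), 0 ≤ κ x)
    (hf : MemLp f 2 (volume.restrict (openBox B))) (hu : IsWeakSolution (openBox B) κ f u)
    (huh : MemH10 (openBox B) uh) (hτ : MemHdiv (openBox B) τ) {κ₀ c : ℝ} (hκ₀ : 0 ≤ κ₀)
    (hc : 0 < c) (hκc : ∀ᵐ x ∂(volume.restrict (openBox B)), c ≤ κ x + κ₀) :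
    energyNorm (openBox B) κ (fun x => u x - uh x) ≤
      eta (openBox B) 𝒯 κ f uh κ₀ τ + κ₀ * poincareConst B *
        √(∑ K ∈ 𝒯, residNorm (openBox B) K κ (resid κ f uh) κ₀ τ ^ 2) := by
  have he : MemH10 (openBox B) fun x => u x - uh x := hu.1.sub huh
  set e := fun x => u x - uh x
  have hsq : energyNorm (openBox B) κ e ^ 2 =
      (∫ x in openBox B, (resid κ f uh x + weakDiv (openBox B) τ x) * e x) +
      ∫ x in openBox B, inner ℝ (τ x - weakGrad (openBox B) uh x) (weakGrad (openBox B) e x) :=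
    energyNorm_sq_eq hκ hf hu huh hτ
  set X := energyNorm (openBox B) κ e with hX
  have hX0 : 0 ≤ X := Real.sqrt_nonneg _
  have hGe := he.1.weakGrad_spec.1
  have hκe := hκ.fun_mul_of_top he.1.1
  have hr : MemLp (resid κ f uh) 2 (volume.restrict (openBox B)) :=
    hf.sub (memLp_sq_mul hκ huh.1.1)
  have hle := fun K (hK : K ∈ 𝒯) => restrict_closedBox_le (h𝒯.subset hK)
  set E := fun K : BoxIntegral.Box (Fin d) =>
    √(l2Norm (closedBox K) (weakGrad (openBox B) e) ^ 2 +
      l2Norm (closedBox K) (fun x => κ x * e x) ^ 2)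
  set a := fun K : BoxIntegral.Box (Fin d) =>
    localEta (openBox B) K κ f uh κ₀ τ + osc K κ (resid κ f uh)
  set ρ := fun K : BoxIntegral.Box (Fin d) => residNorm (openBox B) K κ (resid κ f uh) κ₀ τ
  have hE : ∑ K ∈ 𝒯, E K ^ 2 = X ^ 2 := by
    rw [hX, energyNorm, Real.sq_sqrt (by positivity), h𝒯.l2Norm_sq_eq_sum hGe,
      h𝒯.l2Norm_sq_eq_sum hκe, ← Finset.sum_add_distrib]
    exact Finset.sum_congr rfl fun K _ => Real.sq_sqrt (by positivity)
  have h1 : X ^ 2 ≤ ∑ K ∈ 𝒯, (a K * E K + κ₀ * (ρ K * l2Norm (closedBox K) e)) := by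
    have i1 : Integrable (fun x => (resid κ f uh x + weakDiv (openBox B) τ x) * e x)
        (volume.restrict (openBox B)) :=
      integrable_mul_of_memLp (hr.add hτ.weakDiv_spec.1) he.1.1
    have i2 : Integrable (fun x => inner ℝ (τ x - weakGrad (openBox B) uh x)
        (weakGrad (openBox B) e x)) (volume.restrict (openBox B)) :=
      integrable_inner_of_memLp (hτ.1.sub huh.1.weakGrad_spec.1) hGe
    rw [hsq, h𝒯.setIntegral_eq_sum i1, h𝒯.setIntegral_eq_sum i2, ← Finset.sum_add_distrib]
    exact Finset.sum_le_sum fun K hK => local_error_bound hκ₀ hc (h𝒯.subset hK)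
      (hκ.mono_measure (hle K hK)) (ae_mono (hle K hK) hκ_nonneg) (ae_mono (hle K hK) hκc)
      (hr.mono_measure (hle K hK)) he huh hτ
  have h2 : ∑ K ∈ 𝒯, a K * E K ≤ eta (openBox B) 𝒯 κ f uh κ₀ τ * X := by
    have := Real.sum_mul_le_sqrt_mul_sqrt 𝒯 a E
    rwa [hE, Real.sqrt_sq hX0] at this
  have h3 : ∑ K ∈ 𝒯, ρ K * l2Norm (closedBox K) e ≤ √(∑ K ∈ 𝒯, ρ K ^ 2) * (poincareConst B * X) := by
    refine (Real.sum_mul_le_sqrt_mul_sqrt 𝒯 ρ fun K => l2Norm (closedBox K) e).trans ?_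
    gcongr
    rw [← h𝒯.l2Norm_sq_eq_sum he.1.1, l2Norm, Real.sqrt_sq ENNReal.toReal_nonneg]
    refine (he.l2Norm_le hd).trans (mul_le_mul_of_nonneg_left ?_ (poincareConst_nonneg B))
    exact Real.le_sqrt_of_sq_le (le_add_of_nonneg_right (sq_nonneg _))
  rw [Finset.sum_add_distrib, ← Finset.mul_sum] at h1
  have h4 : X * X ≤ (eta (openBox B) 𝒯 κ f uh κ₀ τ +
      κ₀ * poincareConst B * √(∑ K ∈ 𝒯, ρ K ^ 2)) * X := by
    have := mul_le_mul_of_nonneg_left h3 hκ₀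
    nlinarith
  -- Divide by the energy norm, unless it vanishes.
  rcases hX0.eq_or_lt with h0 | h0
  · rw [← h0]
    have := poincareConst_nonneg B
    exact add_nonneg (Real.sqrt_nonneg _) (by positivity)
  · exact le_of_mul_le_mul_right h4 h0

/-- Here `essInf` is the supremum in `ℝ` of the essential lower bounds of `κ`; as a supremum of
nonpositive numbers, or of the empty set, is not positive, some lower bound is positive. -/
theorem exists_pos_le_of_essInf_pos {α : Type*} [MeasurableSpace α] {μ : Measure α} {κ : α → ℝ}
    (h : 0 < essInf κ μ) : ∃ c, 0 < c ∧ ∀ᵐ x ∂μ, c ≤ κ x := by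
  rw [essInf, liminf_eq] at h
  by_contra hne
  exact h.not_ge (Real.sSup_nonpos fun c hc => not_lt.1 fun hpos => hne ⟨c, hpos, hc⟩)

end ErrorBound

theorem theorem1 {d : ℕ} (hd : 1 ≤ d)
    (B : BoxIntegral.Box (Fin d)) (𝒯 : Finset (BoxIntegral.Box (Fin d))) (h𝒯 : IsMesh B 𝒯)
    (κ f u uh : EuclideanSpace ℝ (Fin d) → ℝ)
    (τ : EuclideanSpace ℝ (Fin d) → EuclideanSpace ℝ (Fin d))
    (hκ : MemLp κ ∞ (volume.restrict (openBox B)))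
    (hκ_nonneg : ∀ᵐ x ∂(volume.restrict (openBox B)), 0 ≤ κ x)
    (hf : MemLp f 2 (volume.restrict (openBox B)))
    (hu : IsWeakSolution (openBox B) κ f u)
    (huh : MemH10 (openBox B) uh)
    (hτ : MemHdiv (openBox B) τ) :
    (∀ κ₀ : ℝ, 0 < κ₀ →
      energyNorm (openBox B) κ (fun x => u x - uh x) ≤
        eta (openBox B) 𝒯 κ f uh κ₀ τ +
          κ₀ * poincareConst B *
            √(∑ K ∈ 𝒯, residNorm (openBox B) K κ (resid κ f uh) κ₀ τ ^ 2)) ∧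
    (0 < essInf κ (volume.restrict (openBox B)) →
      energyNorm (openBox B) κ (fun x => u x - uh x) ≤
        eta (openBox B) 𝒯 κ f uh 0 τ +
          0 * poincareConst B *
            √(∑ K ∈ 𝒯, residNorm (openBox B) K κ (resid κ f uh) 0 τ ^ 2)) := by
  refine ⟨fun κ₀ hκ₀ => ?_, fun hess => ?_⟩
  · refine energyNorm_sub_le hd h𝒯 hκ hκ_nonneg hf hu huh hτ hκ₀.le hκ₀ ?_
    filter_upwards [hκ_nonneg] with x hx
    exact le_add_of_nonneg_left hx
  · obtain ⟨c, hc, hκc⟩ := exists_pos_le_of_essInf_pos hess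
    exact energyNorm_sub_le hd h𝒯 hκ hκ_nonneg hf hu huh hτ le_rfl hc (by simpa using hκc)
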